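/- Throughout, $n=2p$, formal maps fix the origin, $L F$ denotes the linear part at $0$ of a formal map $F$, and $\bar z'$ is treated as an independent formal variable $w'$. A formal submanifold is $$M\colon\ z_{p+j}=E_j(z',\bar z'),\quad 1\le j\le p,\qquad z'=(z_1,\dots,z_p),\quad z''=(z_{p+1},\dots,z_{2p}),$$ where $E_1,\dots,E_p$ are formal power series in $(z',\bar z')$ without constant and linear terms. Let $q_j(w')$ be the quadratic part of $E_j(0,w')$. A formal deck transformation of $\pi_1$ is a formal biholomorphic map $\tau(z',w')=(z',f(z',w'))$ of $\mathbb C^{2p}$ with $E\circ\tau=E$. $M$ satisfies condition D if $q_1=\dots=q_p=0$ only at $w'=0$ and $\pi_1$ has exactly $2^p$ formal deck transformations. Let $\rho_0(z',w')=(\overline{w'},\overline{z'})$. The formal fixed-point set $\operatorname{Fix}(F)$ is defined by the radical of the ideal generated by the components of $F-\mathrm{id}$; it is a hypersurface if this radical is generated by one series $r$ with $r(0)=0$, $dr(0)\ne0$; its tangent space at $0$ is the common kernel of $dr(0)$ over all $r$ in the radical. The family of involutions associated with a manifold $M$ satisfying D is the set $\{\tau_{11},\dots,\tau_{1p}\}$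 of $p$ distinct generators of the group of formal deck transformations of $\pi_1$ such that each $\operatorname{Fix}(\tau_{1j})$ is a hypersurface; this family exists and is unique up to order. $M$ and $\tilde M$ are formally equivalent if $f(M)=\tilde M$ for a formal biholomorphic map $f$ of $(\mathbb C^{2p},0)$, i.e. $f$ and $f^{-1}$ pull back the ideals of $\mathbb C[[z,\bar z]]$ defining $\tilde M$ and $M$ into those defining $M$ and $\tilde M$, respectively. Two families $\{\tau_{11},\dots,\tau_{1p},\rho\}$ and $\{\tilde\tau_{11},\dots,\tilde\tau_{1p},\tilde\rho\}$, with $\rho,\tilde\rho$ anti-holomorphic formal involutions, are formally equivalent if there are a formal biholomorphic map $F$ and a permutation $j\mapsto i_j$ with $F\rho=\tilde\rho F$ and $F\tau_{1j}F^{-1}=\tilde\tau_{1i_j}$ for all $j$. **Proposition.** (i) Let $M,\tilde M$ be formal submanifolds as above that satisfy condition D. Then $M$ and $\tilde M$ are formally equivalent if and only if their associated families $\{\tau_{11},\dots,\tau_{1p},\rho_0\}$ and $\{\tilde\tau_{11},\dots,\tilde\tau_{1p},\rho_0\}$ are formally equivalent. (ii) Let $\tau_{11},\dots,\tau_{1p}$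 be pairwise commuting formal holomorphic involutions of $(\mathbb C^{2p},0)$ such that the tangent spaces at $0$ of $\operatorname{Fix}(\tau_{11}),\dots,\operatorname{Fix}(\tau_{1p})$ are hyperplanes intersecting transversally (their intersection has codimension $p$). Let $\rho$ be an anti-holomorphic formal involution of $(\mathbb C^{2p},0)$ and put $\tau_{2j}=\rho\tau_{1j}\rho$, $\tau_i=\tau_{i1}\cdots\tau_{ip}$. Suppose that the linear part of $\sigma=\tau_1\tau_2$ has $2p$ distinct eigenvalues, and that $0$ is the only linear function that is invariant under all $L\tau_{1j}$ and all $L\tau_{2j}$. Then there are formal power series $B_1,\dots,B_p$ such that $$M\colon\ z''=(B_1^2,\dots,B_p^2)(z',\bar z')$$ is a formal submanifold as above, $M$ satisfies condition D, and its associated family $\{\tilde\tau_{11},\dots,\tilde\tau_{1p},\rho_0\}$ is formally equivalent to $\{\tau_{11},\dots,\tau_{1p},\rho\}$. -/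

import Mathlib

noncomputable section

namespace CRSing

open MvPowerSeries

/-- A formal holomorphic self-map of `ℂ^σ` fixing the origin: a family of formal power series
without constant terms. -/
@[ext]
structure FormalMap (σ : Type) where
  toFun : σ → MvPowerSeries σ ℂ
  map_zero : ∀ i, constantCoeff (toFun i) = 0

variable {σ : Type} [Finite σ]

theorem FormalMap.hasSubst (F : FormalMap σ) : HasSubst F.toFun :=
  hasSubst_of_constantCoeff_zero F.map_zero

/-- The product of formal maps is the composition: `(F * G)(x) = F (G x)`. The units of this
monoid are the formal biholomorphic maps. -/
instance : Monoid (FormalMap σ) where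
  mul F G := ⟨fun i => subst G.toFun (F.toFun i),
    fun i => constantCoeff_subst_eq_zero G.hasSubst G.map_zero (F.map_zero i)⟩
  one := ⟨fun i => X i, fun i => constantCoeff_X i⟩
  mul_assoc F G H := by
    apply FormalMap.ext
    funext i
    exact subst_comp_subst_apply G.hasSubst H.hasSubst (F.toFun i)
  one_mul F := by
    apply FormalMap.ext
    funext i
    exact subst_X F.hasSubst i
  mul_one F := by
    apply FormalMap.ext
    funext i
    exact congrFun (subst_self (R := ℂ)) (F.toFun i)

theorem FormalMap.mul_toFun (F G : FormalMap σ) (i : σ) :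
    (F * G).toFun i = subst G.toFun (F.toFun i) := rfl

theorem FormalMap.one_toFun (i : σ) : (1 : FormalMap σ).toFun i = X i := rfl

/-- Conjugation of all coefficients of a power series: `f ↦ \bar f`, `\bar f (x) = conj (f (conj x))`. -/
def conj {τ : Type} (f : MvPowerSeries τ ℂ) : MvPowerSeries τ ℂ :=
  MvPowerSeries.map (starRingEnd ℂ) f

/-- `F ↦ \bar F`, conjugation of the coefficients of a formal map. -/
def FormalMap.bar : FormalMap σ →* FormalMap σ where
  toFun F := ⟨fun i => conj (F.toFun i), fun i => by
    rw [conj, MvPowerSeries.constantCoeff_map, F.map_zero, RingHom.map_zero]⟩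
  map_one' := by
    apply FormalMap.ext
    funext i
    exact MvPowerSeries.map_X _ i
  map_mul' F G := by
    apply FormalMap.ext
    funext i
    exact map_subst G.hasSubst (F.toFun i)

/-- The group of formal biholomorphic maps of `(ℂ^σ, 0)` under composition. -/
abbrev FormalBihol (σ : Type) [Finite σ] := (FormalMap σ)ˣ

/-- The components of a formal biholomorphic map. -/
def comps (F : FormalBihol σ) : σ → MvPowerSeries σ ℂ := (F : FormalMap σ).toFun

/-- `\bar F` for a formal biholomorphic map `F`. -/
def bar : FormalBihol σ →* FormalBihol σ := Units.map FormalMap.bar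

/-- The matrix of the linear part `LF` of `F` at the origin. -/
def linearPart (F : FormalBihol σ) : Matrix σ σ ℂ :=
  Matrix.of fun i k => coeff (Finsupp.single k 1) (comps F i)

/-- An anti-holomorphic formal map `ρ`, written as `ρ(x) = R(conj x)` with `R` formal
biholomorphic, which is an involution; as `ρ(ρ(x)) = R(\bar R(x))`, this says `R ∘ \bar R = id`. -/
structure AntiInvolution (σ : Type) [Finite σ] where
  R : FormalBihol σ
  invol : R * bar R = 1

/-- The formal holomorphic map `ρ ∘ F ∘ ρ`, that is `x ↦ R (\bar F (\bar R x))`. -/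
def AntiInvolution.conjugate (ρ : AntiInvolution σ) (F : FormalBihol σ) : FormalBihol σ :=
  ρ.R * bar F * bar ρ.R

/-- `F` intertwines two anti-holomorphic involutions: `F ∘ ρ = ρ' ∘ F`, that is
`F (R (conj x)) = R' (\bar F (conj x))`. -/
def Intertwines (F : FormalBihol σ) (ρ ρ' : AntiInvolution σ) : Prop :=
  F * ρ.R = ρ'.R * bar F

/-- The families `{τ₁, …, τ_p, ρ}` and `{τ'₁, …, τ'_p, ρ'}` are formally equivalent: some formal
biholomorphic map conjugates `ρ` to `ρ'` and the `τ_j`, up to their order, to the `τ'_j`. -/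
def FamilyEquivalent {p : ℕ} (τ : Fin p → FormalBihol σ) (ρ : AntiInvolution σ)
    (τ' : Fin p → FormalBihol σ) (ρ' : AntiInvolution σ) : Prop :=
  ∃ F : FormalBihol σ, Intertwines F ρ ρ' ∧
    ∃ e : Equiv.Perm (Fin p), ∀ j, F * τ j * F⁻¹ = τ' (e j)

/-- The linear part at the origin of a formal power series, as a linear function: `dr(0)`. -/
def differential [Fintype σ] (r : MvPowerSeries σ ℂ) : Module.Dual ℂ (σ → ℂ) :=
  ∑ i, coeff (Finsupp.single i 1) r • LinearMap.proj i

/-- The ideal of the formal fixed-point set `Fix(F)`: the radical of the ideal generated by the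
components of `F - id`. -/
def fixIdeal (F : FormalBihol σ) : Ideal (MvPowerSeries σ ℂ) :=
  (Ideal.span (Set.range fun i => comps F i - X i)).radical

/-- The tangent space at the origin of the formal set with ideal `I`. -/
def tangentSpace [Fintype σ] (I : Ideal (MvPowerSeries σ ℂ)) : Submodule ℂ (σ → ℂ) :=
  ⨅ r ∈ I, LinearMap.ker (differential r)

/-- The radical ideal `I` defines a formal (smooth) hypersurface through the origin. -/
def IsFormalHypersurface [Fintype σ] (I : Ideal (MvPowerSeries σ ℂ)) : Prop :=
  ∃ r : MvPowerSeries σ ℂ, I = Ideal.span {r} ∧ constantCoeff r = 0 ∧ differential r ≠ 0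

/-- The space `[𝔐]₁^{L𝓕}` of linear functions which are invariant under the linear parts of all
members of the family `𝓕`. -/
def linearInvariants [Fintype σ] [DecidableEq σ] {p : ℕ} (𝓕 : Fin p → FormalBihol σ) :
    Submodule ℂ (Module.Dual ℂ (σ → ℂ)) :=
  ⨅ j, LinearMap.eqLocus
    (LinearMap.lcomp ℂ ℂ (Matrix.toLin' (linearPart (𝓕 j)))) LinearMap.id

/-- The composition `τ₁ ∘ τ₂ ∘ ⋯ ∘ τ_p`. -/
def composite {p : ℕ} (τ : Fin p → FormalBihol σ) : FormalBihol σ := (List.ofFn τ).prod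

/-- The variables of the complexification: `Sum.inl j` is `z_j` and `Sum.inr j` is `w_j`, the
formal variable that stands for `conj z_j` (`j = 1, …, p`). -/
abbrev ZW (p : ℕ) := Fin p ⊕ Fin p

/-- The exchange `(z', w') ↦ (w', z')`. -/
def swap (p : ℕ) : FormalMap (ZW p) :=
  ⟨fun i => X i.swap, fun i => constantCoeff_X i.swap⟩

theorem swap_mul_swap (p : ℕ) : swap p * swap p = 1 := by
  apply FormalMap.ext
  funext i
  rw [FormalMap.mul_toFun, FormalMap.one_toFun]
  change subst (swap p).toFun (X i.swap) = X i
  rw [subst_X (swap p).hasSubst]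
  change X i.swap.swap = X i
  rw [Sum.swap_swap]

/-- The anti-holomorphic involution `ρ₀(z', w') = (conj w', conj z')`. -/
def rho0 (p : ℕ) : AntiInvolution (ZW p) where
  R := ⟨swap p, swap p, swap_mul_swap p, swap_mul_swap p⟩
  invol := by
    have hbar : FormalMap.bar (swap p) = swap p := by
      apply FormalMap.ext
      funext i
      exact MvPowerSeries.map_X _ i.swap
    apply Units.ext
    change swap p * FormalMap.bar (swap p) = 1
    rw [hbar, swap_mul_swap]

/-- A formal submanifold `z_{p+j} = E_j(z', conj z')`, `1 ≤ j ≤ p`, of `ℂ^{2p}`, where the `E_j` are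
formal power series in `(z', conj z')` without constant or linear terms. -/
structure FormalSubmanifold (p : ℕ) where
  E : Fin p → MvPowerSeries (ZW p) ℂ
  two_le_order : ∀ j, 2 ≤ (E j).order

namespace FormalSubmanifold

variable {p : ℕ}

/-- The part `q_j(w')` of the quadratic form of `E_j(z', w')` that depends on `w'` only. -/
def q (M : FormalSubmanifold p) (j : Fin p) : MvPolynomial (Fin p) ℂ :=
  ∑ d ∈ (Finset.univ : Finset (Fin p)).finsuppAntidiag 2,
    MvPolynomial.monomial d (coeff (Finsupp.mapDomain Sum.inr d) (M.E j))

/-- Condition B: `q` vanishes only at the origin. -/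
def ConditionB (M : FormalSubmanifold p) : Prop :=
  ∀ w : Fin p → ℂ, (∀ j, MvPolynomial.eval w (M.q j) = 0) → w = 0

/-- The group of formal deck transformations of `π₁`: formal biholomorphic maps of the form
`(z', w') ↦ (z', f(z', w'))` with `E(z', f(z', w')) = E(z', w')`. -/
def deck (M : FormalSubmanifold p) : Subgroup (FormalBihol (ZW p)) where
  carrier := {τ | (∀ i, comps τ (Sum.inl i) = X (Sum.inl i)) ∧
    ∀ j, subst (comps τ) (M.E j) = M.E j}
  one_mem' := ⟨fun _ => rfl, fun j => congrFun (subst_self (R := ℂ)) (M.E j)⟩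
  mul_mem' := by
    rintro a b ⟨ha, ha'⟩ ⟨hb, hb'⟩
    have hA : HasSubst (comps a) := FormalMap.hasSubst _
    have hB : HasSubst (comps b) := FormalMap.hasSubst _
    refine ⟨fun i => ?_, fun j => ?_⟩
    · change subst (comps b) (comps a (Sum.inl i)) = _
      rw [ha, subst_X hB, hb]
    · change subst (fun s => subst (comps b) (comps a s)) (M.E j) = _
      rw [← subst_comp_subst_apply hA hB, ha', hb']
  inv_mem' := by
    rintro a ⟨ha, ha'⟩
    have hA : HasSubst (comps a) := FormalMap.hasSubst _
    have hB : HasSubst (comps a⁻¹) := FormalMap.hasSubst _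
    have h : ∀ s, subst (comps a⁻¹) (comps a s) = X s := fun s =>
      congrFun (congrArg FormalMap.toFun a.mul_inv) s
    refine ⟨fun i => ?_, fun j => ?_⟩
    · have := h (Sum.inl i)
      rwa [ha, subst_X hB] at this
    · have := subst_comp_subst_apply hA hB (M.E j)
      rw [ha', funext h] at this
      exact this.trans (congrFun (subst_self (R := ℂ)) (M.E j))

/-- Condition D: condition B holds and `π₁` has the maximal number `2^p` of formal deck
transformations. -/
def ConditionD (M : FormalSubmanifold p) : Prop :=
  M.ConditionB ∧ Nat.card M.deck = 2 ^ p

/-- `{τ₁, …, τ_p}` is the family of involutions associated with `M`: `p` distinct generators of the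
group of deck transformations of `π₁`, each of which fixes a hypersurface. -/
def IsAssociatedFamily (M : FormalSubmanifold p) (τ : Fin p → FormalBihol (ZW p)) : Prop :=
  Function.Injective τ ∧ Subgroup.closure (Set.range τ) = M.deck ∧
    ∀ j, IsFormalHypersurface (fixIdeal (τ j))

/-- The coordinates `z = (z', z'')` and `w = (w', w'')` of `ℂ^{2p} × ℂ^{2p}`, `w` being the formal
variable for `conj z`: the left copy of `ZW p` indexes `z`, the right one `w`; in each of them
`Sum.inl` indexes the first `p` coordinates and `Sum.inr` the last `p`. -/
abbrev Ambient (p : ℕ) := (Fin p ⊕ Fin p) ⊕ (Fin p ⊕ Fin p)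

/-- The ideal `I(M)` in `ℂ[[z, conj z]]`, generated by `z'' - E(z', conj z')` and by the conjugate
equations `conj z'' - \bar E(conj z', z')`. -/
def ideal (M : FormalSubmanifold p) : Ideal (MvPowerSeries (Ambient p) ℂ) :=
  Ideal.span
    (Set.range (fun j : Fin p => X (Sum.inl (Sum.inr j)) -
        subst (Sum.elim (fun i => X (Sum.inl (Sum.inl i))) (fun i => X (Sum.inr (Sum.inl i))) :
          ZW p → MvPowerSeries (Ambient p) ℂ) (M.E j)) ∪
      Set.range (fun j : Fin p => X (Sum.inr (Sum.inr j)) -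
        subst (Sum.elim (fun i => X (Sum.inr (Sum.inl i))) (fun i => X (Sum.inl (Sum.inl i))) :
          ZW p → MvPowerSeries (Ambient p) ℂ) (conj (M.E j))))

/-- The map `(z, conj z) ↦ (f(z), conj (f(z)))`, i.e. `(z, w) ↦ (f(z), \bar f(w))`. -/
def complexify (f : FormalBihol (Fin p ⊕ Fin p)) : Ambient p → MvPowerSeries (Ambient p) ℂ :=
  Sum.elim
    (fun i => subst (fun k => X (Sum.inl k) :
      Fin p ⊕ Fin p → MvPowerSeries (Ambient p) ℂ) (comps f i))
    (fun i => subst (fun k => X (Sum.inr k) :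
      Fin p ⊕ Fin p → MvPowerSeries (Ambient p) ℂ) (conj (comps f i)))

/-- The formal holomorphic map `f` of `ℂ^{2p}` maps `M` into `M'`: `I(M') ∘ f ⊆ I(M)`. -/
def MapsInto (f : FormalBihol (Fin p ⊕ Fin p)) (M M' : FormalSubmanifold p) : Prop :=
  ∀ r ∈ M'.ideal, subst (complexify f) r ∈ M.ideal

/-- `M` and `M'` are formally equivalent: `f(M) = M'` for a formal biholomorphic map `f` of
`(ℂ^{2p}, 0)`. -/
def FormallyEquivalent (M M' : FormalSubmanifold p) : Prop :=
  ∃ f : FormalBihol (Fin p ⊕ Fin p), MapsInto f M M' ∧ MapsInto f⁻¹ M' M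

end FormalSubmanifold

end CRSing

end

/-!
The deck transformations of `π₁` form a finite elementary abelian 2-group, and averaging over it
produces fiberwise coordinates `U` in which it becomes the group of all sign changes of `w'`.
Consequently `(z', E) = e ∘ (z', w'²) ∘ U` with `e` invertible, so every formal map invariant under
the deck group factors through `(z', E)`: a formal map commuting with `ρ₀` and conjugating the deck
groups descends to an equivalence of the manifolds, while conversely an equivalence of the
manifolds lifts to such a map by complexification.

For the realization, averaging linearizes the commuting involutions to sign changes of `p`
coordinates. The `p` invariant coordinates and their conjugates under `ρ` together form a coordinate
system `(z', w')`, because the linear parts of the two families have no common invariant, and there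
`ρ` becomes `ρ₀`. The `p` anti-invariant coordinates, written in terms of `(z', w')`, are the
`B_j`.
-/

noncomputable section

namespace CRSing

open MvPowerSeries Matrix

section Order

variable {σ τ R : Type*} [CommRing R]

theorem natCast_le_order_iff {f : MvPowerSeries σ R} {n : ℕ} :
    (n : ℕ∞) ≤ f.order ↔ ∀ d : σ →₀ ℕ, d.degree < n → coeff d f = 0 :=
  ⟨fun h _ hd => coeff_of_lt_order (lt_of_lt_of_le (by exact_mod_cast hd) h), nat_le_order⟩

theorem le_order_add {f g : MvPowerSeries σ R} {n : ℕ∞} (hf : n ≤ f.order) (hg : n ≤ g.order) :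
    n ≤ (f + g).order :=
  (le_min hf hg).trans min_order_le_add

theorem le_order_sum {ι : Type*} {s : Finset ι} {f : ι → MvPowerSeries σ R} {n : ℕ∞}
    (h : ∀ i ∈ s, n ≤ (f i).order) : n ≤ (∑ i ∈ s, f i).order :=
  Finset.sum_induction f (n ≤ ·.order) (fun _ _ => le_order_add) (by simp) h

theorem order_le_order_subst {a : σ → MvPowerSeries τ R} (ha : HasSubst a)
    (ha0 : ∀ i, constantCoeff (a i) = 0) (f : MvPowerSeries σ R) :
    f.order ≤ (subst a f).order :=
  (le_mul_of_one_le_left' (le_iInf fun i => one_le_order_iff_constCoeff_eq_zero.mpr (ha0 i))).trans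
    (le_order_subst ha f)

theorem constantCoeff_subst_of_constantCoeff_zero {a : σ → MvPowerSeries τ R} (ha : HasSubst a)
    (ha0 : ∀ i, constantCoeff (a i) = 0) (f : MvPowerSeries σ R) :
    constantCoeff (subst a f) = constantCoeff f := by
  have h := constantCoeff_subst_eq_zero ha ha0 (f := f - C (constantCoeff f)) (by simp)
  rwa [subst_sub ha, subst_C, map_sub, constantCoeff_C, sub_eq_zero] at h

end Order

section LinearTerms

variable {σ τ R : Type*} [CommRing R]

/-- The coefficients of the linear part of a formal power series. -/
def linCoeff : MvPowerSeries σ R →ₗ[R] σ → R :=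
  LinearMap.pi fun k => coeff (Finsupp.single k 1)

theorem linCoeff_apply (f : MvPowerSeries σ R) (k : σ) :
    linCoeff f k = coeff (Finsupp.single k 1) f := rfl

theorem linCoeff_X [DecidableEq σ] (i : σ) :
    linCoeff (X i : MvPowerSeries σ R) = Pi.single i 1 := by
  ext k
  simp only [linCoeff_apply, coeff_X, Finsupp.single_left_inj one_ne_zero, Pi.single_apply]

theorem linCoeff_C (r : R) : linCoeff (C r : MvPowerSeries σ R) = 0 := by
  classical
  ext k
  simp [linCoeff_apply, coeff_C]

theorem linCoeff_mul (f g : MvPowerSeries σ R) :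
    linCoeff (f * g) = constantCoeff f • linCoeff g + constantCoeff g • linCoeff f := by
  classical
  ext k
  simp [linCoeff_apply, coeff_mul, Finsupp.antidiagonal_single, mul_comm,
    Finset.Nat.antidiagonal_succ]

theorem two_le_order_iff {f : MvPowerSeries σ R} :
    2 ≤ f.order ↔ constantCoeff f = 0 ∧ linCoeff f = 0 := by
  have h := natCast_le_order_iff (f := f) (n := 2)
  rw [Nat.cast_ofNat] at h
  rw [h]
  refine ⟨fun h => ⟨h 0 (by simp), funext fun k => h _ (by simp)⟩, fun ⟨h0, h1⟩ d hd => ?_⟩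
  obtain hd | hd : d.degree = 0 ∨ d.degree = 1 := by omega
  · rwa [(Finsupp.degree_eq_zero_iff d).mp hd]
  · obtain ⟨k, rfl⟩ : d ∈ Set.range fun k : σ => Finsupp.single k 1 := by
      rwa [Finsupp.range_single_one]
    exact congrFun h1 k

variable [Fintype σ]

/-- The linear form with given coefficients, as a formal power series. -/
def linForm (a : σ → R) : MvPowerSeries σ R := ∑ i, a i • X i

theorem constantCoeff_linForm (a : σ → R) : constantCoeff (linForm a) = 0 := by
  simp [linForm]

theorem linCoeff_linForm (a : σ → R) : linCoeff (linForm a) = a := by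
  classical
  simp only [linForm, map_sum, map_smul, linCoeff_X]
  exact (pi_eq_sum_univ' a).symm

theorem subst_linForm {a : σ → MvPowerSeries τ R} (ha : HasSubst a) (c : σ → R) :
    subst a (linForm c) = ∑ i, c i • a i := by
  simp only [linForm, ← substAlgHom_apply (R := R) ha, map_sum, map_smul, substAlgHom_X]

theorem coeff_subst_of_degree_lt {a : σ → MvPowerSeries τ R} {n : ℕ} (hn : n ≠ 0)
    (ha : ∀ i, (n : ℕ∞) ≤ (a i).order) (f : MvPowerSeries σ R) {d : τ →₀ ℕ} (hd0 : d ≠ 0)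
    (hd : d.degree < n * 2) :
    coeff d (subst a f) = ∑ i, linCoeff f i * coeff d (a i) := by
  classical
  have has : HasSubst a := hasSubst_of_constantCoeff_zero fun i =>
    one_le_order_iff_constCoeff_eq_zero.mp
      (le_trans (by exact_mod_cast Nat.one_le_iff_ne_zero.mpr hn) (ha i))
  set g := f - C (constantCoeff f) - linForm (linCoeff f) with hg
  have hg2 : 2 ≤ g.order := by
    refine two_le_order_iff.mpr ⟨?_, ?_⟩
    · simp [hg, constantCoeff_linForm]
    · simp [hg, linCoeff_C, linCoeff_linForm]
  have hf : f = g + C (constantCoeff f) + linForm (linCoeff f) := by rw [hg]; ring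
  have hd' : coeff d (subst a g) = 0 :=
    coeff_of_lt_order (lt_of_lt_of_le (by exact_mod_cast hd)
      ((mul_le_mul' (le_iInf ha) hg2).trans (le_order_subst has g)))
  conv_lhs => rw [hf]
  rw [subst_add has, subst_add has, subst_C, subst_linForm has, map_add, map_add, hd', coeff_C,
    if_neg hd0, zero_add, zero_add, map_sum]
  simp only [map_smul, smul_eq_mul]

theorem linCoeff_subst {a : σ → MvPowerSeries τ R} (ha : ∀ i, constantCoeff (a i) = 0)
    (f : MvPowerSeries σ R) :
    linCoeff (subst a f) = linCoeff f ᵥ* Matrix.of fun i => linCoeff (a i) := by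
  ext k
  exact coeff_subst_of_degree_lt one_ne_zero
    (fun i => by exact_mod_cast one_le_order_iff_constCoeff_eq_zero.mpr (ha i)) f
    (d := Finsupp.single k 1) (by simp) (by simp)

theorem coeff_subst_smul_X (w : σ → R) (f : MvPowerSeries σ R) (t : τ) (n : ℕ) [DecidableEq σ] :
    coeff (Finsupp.single t n) (subst (fun i => w i • (X t : MvPowerSeries τ R)) f) =
      ∑ d ∈ (Finset.univ : Finset σ).finsuppAntidiag n, coeff d f * ∏ i, w i ^ d i := by
  classical
  have hmem (d : σ →₀ ℕ) : d ∈ (Finset.univ : Finset σ).finsuppAntidiag n ↔ d.degree = n := by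
    simp [Finset.mem_finsuppAntidiag, Finsupp.degree_eq_sum]
  have hprod (d : σ →₀ ℕ) : (d.prod fun i k => (w i • (X t : MvPowerSeries τ R)) ^ k) =
      (∏ i, w i ^ d i) • X t ^ d.degree := by
    rw [Finsupp.prod_fintype _ _ (by simp), Finsupp.degree_eq_sum, ← Finset.prod_pow_eq_pow_sum]
    simp only [smul_pow, Finset.prod_smul]
  have ha : HasSubst fun i => w i • (X t : MvPowerSeries τ R) :=
    hasSubst_of_constantCoeff_zero fun i => by simp
  rw [coeff_subst ha]
  simp only [hprod, map_smul, smul_eq_mul, coeff_X_pow]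
  rw [finsum_eq_sum_of_support_subset (s := (Finset.univ : Finset σ).finsuppAntidiag n)]
  · refine Finset.sum_congr rfl fun d hd => ?_
    rw [(hmem d).mp hd, if_pos rfl, mul_one]
  · intro d hd
    rw [Finset.mem_coe, hmem]
    by_contra hne
    refine hd ?_
    beta_reduce
    rw [if_neg fun h => hne (Finsupp.single_injective t h).symm, mul_zero, mul_zero]

end LinearTerms

section Hadamard

variable {σ τ R : Type*} [CommRing R]

theorem exists_eq_sum_X_mul (S : Finset σ) {f : MvPowerSeries σ R}
    (hf : ∀ m : σ →₀ ℕ, (∀ i ∈ S, m i = 0) → coeff m f = 0) :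
    ∃ g : σ → MvPowerSeries σ R,
      f = ∑ i ∈ S, X i * g i ∧ ∀ i, f.order ≤ (g i).order + 1 := by
  classical
  cases isEmpty_or_nonempty σ
  · exact ⟨0, by ext m; simp [hf m fun i => isEmptyElim i], isEmptyElim⟩
  have hpick (m : σ →₀ ℕ) (hm : coeff m f ≠ 0) : ∃ i ∈ S, m i ≠ 0 := by
    by_contra! h
    exact hm (hf m h)
  -- each monomial of `f` is assigned to one variable `X i`, `i ∈ S`, that divides it
  choose! pick hpickS hpick using hpick
  let g (i : σ) : MvPowerSeries σ R := fun e =>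
    if pick (e + Finsupp.single i 1) = i then coeff (e + Finsupp.single i 1) f else 0
  have hg (i : σ) (e : σ →₀ ℕ) : coeff e (g i) =
    if pick (e + Finsupp.single i 1) = i then coeff (e + Finsupp.single i 1) f else 0 := rfl
  refine ⟨g, ?_, fun i => ?_⟩
  · ext d
    have hterm (i : σ) : coeff d (X i * g i) = if pick d = i then coeff d f else 0 := by
      rw [X_def, coeff_monomial_mul, one_mul, hg]
      by_cases hle : Finsupp.single i 1 ≤ d
      · rw [if_pos hle, tsub_add_cancel_of_le hle]
      · rw [if_neg hle]
        split_ifs with hi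
        · by_contra hd
          exact hle (Finsupp.single_le_iff.mpr
            (Nat.one_le_iff_ne_zero.mpr (hi ▸ hpick d (Ne.symm hd))))
        · rfl
    simp only [map_sum, hterm, Finset.sum_ite_eq]
    split_ifs with hS
    · rfl
    · by_contra hd
      exact hS (hpickS d hd)
  · rw [← tsub_le_iff_right]
    refine le_order fun e he => ?_
    rw [hg, coeff_of_lt_order (d := e + Finsupp.single i 1), ite_self]
    rw [map_add, Finsupp.degree_single]
    exact_mod_cast lt_tsub_iff_right.mp he

theorem exists_subst_add_sub_subst_eq_sum_X_mul [Fintype σ] (f : MvPowerSeries σ R) :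
    ∃ g : σ → MvPowerSeries (σ ⊕ σ) R,
      subst (fun i => X (Sum.inl i) + X (Sum.inr i) : σ → MvPowerSeries (σ ⊕ σ) R) f -
          subst (fun i => X (Sum.inl i) : σ → MvPowerSeries (σ ⊕ σ) R) f =
        ∑ i, X (Sum.inr i) * g i ∧
      ∀ i, f.order ≤ (g i).order + 1 := by
  set F : MvPowerSeries (σ ⊕ σ) R := subst (fun i => X (Sum.inl i) + X (Sum.inr i)) f
  set F₀ : MvPowerSeries (σ ⊕ σ) R := subst (fun i => X (Sum.inl i)) f
  have hXX : HasSubst fun i => (X (Sum.inl i) + X (Sum.inr i) : MvPowerSeries (σ ⊕ σ) R) :=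
    hasSubst_of_constantCoeff_zero fun i => by simp
  have hX : HasSubst fun i => (X (Sum.inl i) : MvPowerSeries (σ ⊕ σ) R) :=
    hasSubst_of_constantCoeff_zero fun i => by simp
  have hrescale : rescale (Sum.elim 1 0) (F - F₀) = 0 := by
    have hc := HasSubst.smul_X (Sum.elim 1 0 : σ ⊕ σ → R)
    rw [rescale_eq_subst, subst_sub hc, subst_comp_subst_apply hXX hc,
      subst_comp_subst_apply hX hc]
    simp [subst_add hc, subst_X hc]
  obtain ⟨g, hFg, hg⟩ := exists_eq_sum_X_mul (Finset.univ.map Function.Embedding.inr)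
    (f := F - F₀) fun m hm => by
      have h := coeff_rescale (F - F₀) (Sum.elim 1 0) m
      rw [hrescale, map_zero, Finsupp.prod, Finset.prod_eq_one, one_mul] at h
      · exact h.symm
      · rintro (i | i) hi
        · simp
        · exact absurd (hm (Sum.inr i) (by simp)) (Finsupp.mem_support_iff.mp hi)
  refine ⟨fun i => g (Sum.inr i), by simpa using hFg, fun i => le_trans ?_ (hg (Sum.inr i))⟩
  rw [sub_eq_add_neg]
  exact le_order_add (order_le_order_subst hXX (fun i => by simp) f)
    (by rw [order_neg]; exact order_le_order_subst hX (fun i => by simp) f)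

theorem exists_subst_sub_subst_eq_sum_sub_mul [Fintype σ] {a b : σ → MvPowerSeries τ R}
    (ha : ∀ i, constantCoeff (a i) = 0) (hb : ∀ i, constantCoeff (b i) = 0)
    (f : MvPowerSeries σ R) : ∃ h : σ → MvPowerSeries τ R,
      subst a f - subst b f = ∑ i, (a i - b i) * h i ∧ ∀ i, f.order ≤ (h i).order + 1 := by
  obtain ⟨g, hfg, hg⟩ := exists_subst_add_sub_subst_eq_sum_X_mul f
  have hab0 : ∀ i, constantCoeff (Sum.elim b (a - b) i) = 0 := by simp [ha, hb]
  have hab : HasSubst (Sum.elim b (a - b)) := hasSubst_of_constantCoeff_zero hab0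
  refine ⟨fun i => subst (Sum.elim b (a - b)) (g i), ?_, fun i =>
    (hg i).trans (add_le_add_left (order_le_order_subst hab hab0 _) 1)⟩
  have h := congrArg (subst (Sum.elim b (a - b))) hfg
  rw [subst_sub hab,
    subst_comp_subst_apply (hasSubst_of_constantCoeff_zero fun i => by simp) hab,
    subst_comp_subst_apply (hasSubst_of_constantCoeff_zero fun i => by simp) hab] at h
  simpa only [← substAlgHom_apply (R := R) hab, map_add, map_sum, map_mul, substAlgHom_X,
    Sum.elim_inl, Sum.elim_inr, Pi.sub_apply, add_sub_cancel] using h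

theorem add_one_le_order_subst_sub_subst [Finite σ] {a b : σ → MvPowerSeries τ R}
    (ha : ∀ i, constantCoeff (a i) = 0) (hb : ∀ i, constantCoeff (b i) = 0)
    (hab : ∀ i, 2 ≤ (a i - b i).order) (f : MvPowerSeries σ R) :
    f.order + 1 ≤ (subst a f - subst b f).order := by
  cases nonempty_fintype σ
  obtain ⟨h, hfh, hh⟩ := exists_subst_sub_subst_eq_sum_sub_mul ha hb f
  rw [hfh]
  refine le_order_sum fun i _ => ?_
  calc f.order + 1 ≤ 2 + (h i).order := by
        rw [add_comm, ← one_add_one_eq_two, add_assoc, add_comm 1 (h i).order]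
        exact add_le_add_right (hh i) 1
    _ ≤ (a i - b i).order + (h i).order := add_le_add_left (hab i) _
    _ ≤ ((a i - b i) * h i).order := le_order_mul

theorem subst_sub_subst_mem_span [Finite σ] {a b : σ → MvPowerSeries τ R}
    (ha : ∀ i, constantCoeff (a i) = 0) (hb : ∀ i, constantCoeff (b i) = 0)
    (f : MvPowerSeries σ R) :
    subst a f - subst b f ∈ Ideal.span (Set.range fun i => a i - b i) := by
  cases nonempty_fintype σ
  obtain ⟨h, hfh, -⟩ := exists_subst_sub_subst_eq_sum_sub_mul ha hb f
  rw [hfh]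
  exact sum_mem fun i _ => Ideal.mul_mem_right _ _ (Ideal.subset_span ⟨i, rfl⟩)

end Hadamard

section InverseFunctionTheorem

theorem exists_sub_apply_eq_of_order_add_one_le {σ R : Type*} [CommRing R]
    {T : Module.End R (MvPowerSeries σ R)} (hT : ∀ f, f.order + 1 ≤ (T f).order)
    (f : MvPowerSeries σ R) : ∃ g, g - T g = f := by
  have hpow (n : ℕ) : (n : ℕ∞) ≤ ((T ^ n) f).order := by
    induction n with
    | zero => simp
    | succ n ih =>
      rw [pow_succ', Module.End.mul_apply, Nat.cast_succ]
      exact (add_le_add_left ih 1).trans (hT _)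
  let S (N : ℕ) : MvPowerSeries σ R := ∑ n ∈ Finset.range N, (T ^ n) f
  have hS (N : ℕ) : S N - T (S N) = f - (T ^ N) f := by
    simp only [S, map_sum, ← Module.End.mul_apply, ← pow_succ', ← Finset.sum_sub_distrib]
    simpa using Finset.sum_range_sub' (fun n => (T ^ n) f) N
  -- the Neumann series `∑ Tⁿ f`, whose coefficients are finite sums because `T` raises the order
  let g : MvPowerSeries σ R := fun d => coeff d (S (d.degree + 1))
  have hgS (N : ℕ) : (N : ℕ∞) ≤ (g - S N).order := by
    refine nat_le_order fun d hd => ?_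
    have hconst : coeff d (S N) = coeff d (S (d.degree + 1)) := by
      simp only [S, map_sum]
      exact Finset.eventually_constant_sum
        (fun n hn => coeff_of_lt_order (lt_of_lt_of_le (by exact_mod_cast hn) (hpow n))) hd
    rw [map_sub, hconst]
    exact sub_self _
  refine ⟨g, ext fun d => ?_⟩
  set N := d.degree + 1
  have hlt : (d.degree : ℕ∞) < N := by exact_mod_cast Nat.lt_succ_self d.degree
  have hsplit : g - T g = f - (T ^ N) f + ((g - S N) - T (g - S N)) := by
    rw [← hS, map_sub]
    ring
  rw [hsplit, map_add, map_sub, map_sub, coeff_of_lt_order (hlt.trans_le (hpow N)),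
    coeff_of_lt_order (hlt.trans_le (hgS N)),
    coeff_of_lt_order (hlt.trans_le ((hgS N).trans (le_self_add.trans (hT _))))]
  ring

variable {σ : Type} [Fintype σ] [DecidableEq σ]

/-- The Jacobian matrix of a formal map at the origin. -/
def jacobian : FormalMap σ →* Matrix σ σ ℂ where
  toFun F := of fun i => linCoeff (F.toFun i)
  map_one' := by
    ext i k
    simp [FormalMap.one_toFun, linCoeff_X, one_apply, Pi.single_apply, eq_comm]
  map_mul' F G := by
    ext i k
    rw [of_apply, FormalMap.mul_toFun, linCoeff_subst G.map_zero]
    rfl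

theorem jacobian_apply (F : FormalMap σ) (i : σ) : jacobian F i = linCoeff (F.toFun i) := rfl

/-- The linear formal map with a given matrix. -/
def FormalMap.ofMatrix (A : Matrix σ σ ℂ) : FormalMap σ :=
  ⟨fun i => linForm (A i), fun i => constantCoeff_linForm (A i)⟩

theorem jacobian_ofMatrix (A : Matrix σ σ ℂ) : jacobian (FormalMap.ofMatrix A) = A :=
  funext fun i => linCoeff_linForm (A i)

theorem FormalMap.exists_mul_eq_one_of_jacobian_eq_one {F : FormalMap σ} (hF : jacobian F = 1) :
    ∃ G : FormalMap σ, G * F = 1 := by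
  have hFX (i : σ) : 2 ≤ (F.toFun i - X i).order := by
    refine two_le_order_iff.mpr ⟨by rw [map_sub, F.map_zero, constantCoeff_X, sub_zero], ?_⟩
    rw [map_sub, sub_eq_zero, ← jacobian_apply, hF, ← map_one jacobian]
    rfl
  have hT (f : MvPowerSeries σ ℂ) : f.order + 1 ≤ (f - subst F.toFun f).order := by
    have h := add_one_le_order_subst_sub_subst F.map_zero constantCoeff_X hFX f
    rwa [subst_self, id_eq, ← neg_sub, order_neg] at h
  have hsurj (i : σ) : ∃ g : MvPowerSeries σ ℂ, subst F.toFun g = X i := by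
    obtain ⟨g, hg⟩ := exists_sub_apply_eq_of_order_add_one_le
      (T := 1 - (substAlgHom F.hasSubst).toLinearMap) (by simpa using hT) (X i)
    exact ⟨g, by simpa using hg⟩
  choose g hg using hsurj
  refine ⟨⟨g, fun i => ?_⟩, FormalMap.ext (funext hg)⟩
  rw [← constantCoeff_subst_of_constantCoeff_zero F.hasSubst F.map_zero, hg, constantCoeff_X]

theorem FormalMap.exists_mul_eq_one {F : FormalMap σ} (hF : IsUnit (jacobian F)) :
    ∃ G : FormalMap σ, G * F = 1 := by
  obtain ⟨A, hA⟩ := hF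
  obtain ⟨G, hG⟩ := exists_mul_eq_one_of_jacobian_eq_one
    (F := FormalMap.ofMatrix (↑A⁻¹ : Matrix σ σ ℂ) * F)
    (by rw [map_mul, jacobian_ofMatrix, ← hA, Units.inv_mul])
  exact ⟨_, (mul_assoc _ _ _).trans hG⟩

theorem FormalMap.isUnit_iff_isUnit_jacobian {F : FormalMap σ} :
    IsUnit F ↔ IsUnit (jacobian F) := by
  refine ⟨fun h => h.map jacobian, fun h => ?_⟩
  obtain ⟨G, hGF⟩ := exists_mul_eq_one h
  have hG : IsUnit (jacobian G) :=
    IsUnit.of_mul_eq_one (jacobian F) (by rw [← map_mul, hGF, map_one])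
  obtain ⟨K, hKG⟩ := exists_mul_eq_one hG
  have hK : K = F := left_inv_eq_right_inv hKG hGF
  exact ⟨⟨F, G, hK ▸ hKG, hGF⟩, rfl⟩

end InverseFunctionTheorem

section FormalBihol

section Finite

variable {σ : Type} [Finite σ]

theorem comps_mul (F G : FormalBihol σ) (i : σ) :
    comps (F * G) i = subst (comps G) (comps F i) := rfl

theorem comps_one (i : σ) : comps (1 : FormalBihol σ) i = X i := rfl

theorem hasSubst_comps (F : FormalBihol σ) : HasSubst (comps F) := FormalMap.hasSubst _

theorem constantCoeff_comps (F : FormalBihol σ) (i : σ) : constantCoeff (comps F i) = 0 :=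
  FormalMap.map_zero _ i

theorem subst_comps_mul (F G : FormalBihol σ) (f : MvPowerSeries σ ℂ) :
    subst (comps (F * G)) f = subst (comps G) (subst (comps F) f) :=
  (subst_comp_subst_apply (hasSubst_comps F) (hasSubst_comps G) f).symm

theorem subst_comps_one (f : MvPowerSeries σ ℂ) : subst (comps (1 : FormalBihol σ)) f = f :=
  congrFun subst_self f

theorem formalBihol_ext {F G : FormalBihol σ} (h : ∀ i, comps F i = comps G i) : F = G :=
  Units.ext (FormalMap.ext (funext h))

theorem linCoeff_comps (F : FormalBihol σ) (i : σ) : linCoeff (comps F i) = linearPart F i := rfl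

theorem linearPart_one [DecidableEq σ] : linearPart (1 : FormalBihol σ) = 1 := by
  cases nonempty_fintype σ
  exact map_one jacobian

end Finite

variable {σ : Type} [Fintype σ]

theorem linCoeff_subst_comps (F : FormalBihol σ) (f : MvPowerSeries σ ℂ) :
    linCoeff (subst (comps F) f) = linCoeff f ᵥ* linearPart F :=
  linCoeff_subst (constantCoeff_comps F) f

theorem linearPart_mul (F G : FormalBihol σ) :
    linearPart (F * G) = linearPart F * linearPart G := by
  classical
  exact map_mul jacobian _ _

variable [DecidableEq σ]

theorem linearPart_eq_jacobian (F : FormalBihol σ) :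
    linearPart F = jacobian (F : FormalMap σ) := rfl

theorem isUnit_linearPart (F : FormalBihol σ) : IsUnit (linearPart F) := F.isUnit.map jacobian

theorem exists_formalBihol_comps_eq {f : σ → MvPowerSeries σ ℂ}
    (h0 : ∀ i, constantCoeff (f i) = 0) (hf : IsUnit (of fun i => linCoeff (f i))) :
    ∃ F : FormalBihol σ, comps F = f := by
  obtain ⟨F, hF⟩ := FormalMap.isUnit_iff_isUnit_jacobian (F := ⟨f, h0⟩).mpr hf
  exact ⟨F, congrArg FormalMap.toFun hF⟩

end FormalBihol

section Fiberwise

variable {p : ℕ}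

/-- The formal map is fibered over `z'`: it has the form `(z', w') ↦ (z', f(z', w'))`. -/
def FormalMap.IsFiberwise (F : FormalMap (ZW p)) : Prop :=
  ∀ i, F.toFun (Sum.inl i) = X (Sum.inl i)

/-- The formal map `(z', w') ↦ (z', f(z', w'))`. -/
def FormalMap.ofFiber (f : Fin p → MvPowerSeries (ZW p) ℂ) (hf : ∀ k, constantCoeff (f k) = 0) :
    FormalMap (ZW p) where
  toFun := Sum.elim (fun i => X (Sum.inl i)) f
  map_zero := Sum.rec (fun _ => constantCoeff_X _) hf

theorem FormalMap.isFiberwise_ofFiber (f : Fin p → MvPowerSeries (ZW p) ℂ)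
    (hf : ∀ k, constantCoeff (f k) = 0) : (ofFiber f hf).IsFiberwise := fun _ => rfl

/-- The block of the Jacobian matrix that maps the `w'`-directions to the `w'`-directions. -/
def FormalMap.wBlock (F : FormalMap (ZW p)) : Matrix (Fin p) (Fin p) ℂ :=
  (jacobian F).toBlocks₂₂

theorem FormalMap.wBlock_one : wBlock (1 : FormalMap (ZW p)) = 1 := by
  rw [wBlock, map_one, ← fromBlocks_one, toBlocks_fromBlocks₂₂]

namespace FormalMap.IsFiberwise

theorem jacobian_eq_fromBlocks {F : FormalMap (ZW p)} (hF : F.IsFiberwise) :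
    jacobian F = fromBlocks 1 0 (jacobian F).toBlocks₂₁ F.wBlock := by
  have hinl (i : Fin p) : jacobian F (Sum.inl i) = Pi.single (Sum.inl i) 1 := by
    rw [jacobian_apply, hF, linCoeff_X]
  refine ext_iff_blocks.mpr ⟨?_, ?_, rfl, rfl⟩
  · ext i k
    simp [toBlocks₁₁, hinl, one_apply, Pi.single_apply, eq_comm]
  · ext i k
    simp [toBlocks₁₂, hinl]

theorem isUnit_iff_isUnit_wBlock {F : FormalMap (ZW p)} (hF : F.IsFiberwise) :
    IsUnit F ↔ IsUnit F.wBlock := by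
  rw [isUnit_iff_isUnit_jacobian, hF.jacobian_eq_fromBlocks, isUnit_fromBlocks_zero₁₂,
    and_iff_right isUnit_one]

theorem wBlock_mul (F : FormalMap (ZW p)) {G : FormalMap (ZW p)} (hG : G.IsFiberwise) :
    (F * G).wBlock = F.wBlock * G.wBlock := by
  rw [wBlock, map_mul, hG.jacobian_eq_fromBlocks, ← fromBlocks_toBlocks (jacobian F),
    fromBlocks_multiply, toBlocks_fromBlocks₂₂, mul_zero, zero_add]
  rfl

end FormalMap.IsFiberwise

end Fiberwise

section Averaging

variable {H : Type*} [Group H] {σ : Type} [Fintype σ]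

theorem character_ne_zero (χ : H →* ℂ) (h : H) : χ h ≠ 0 :=
  ((Group.isUnit h).map χ).ne_zero

theorem exists_semiinvariant [Finite H] (ψ : H →* FormalBihol σ) (χ : H →* ℂ)
    {V : Type*} [AddCommGroup V] [Module ℂ V] (P : (σ → ℂ) →ₗ[ℂ] V) {a : σ → ℂ}
    (ha : ∀ h, P (a ᵥ* linearPart (ψ h)) = χ h • P a) :
    ∃ g : MvPowerSeries σ ℂ, constantCoeff g = 0 ∧ P (linCoeff g) = P a ∧
      ∀ h, subst (comps (ψ h)) g = χ h • g := by
  cases nonempty_fintype H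
  -- averaging with the weight `χ⁻¹` is the projection onto the `χ`-isotypic part
  let g : MvPowerSeries σ ℂ :=
    (Fintype.card H : ℂ)⁻¹ • ∑ h, (χ h)⁻¹ • subst (comps (ψ h)) (linForm a)
  have hcard : (Fintype.card H : ℂ) ≠ 0 := Nat.cast_ne_zero.mpr Fintype.card_ne_zero
  refine ⟨g, ?_, ?_, fun k => ?_⟩
  · have h0 (h : H) : constantCoeff (subst (comps (ψ h)) (linForm a)) = 0 := by
      rw [constantCoeff_subst_of_constantCoeff_zero (hasSubst_comps _) (constantCoeff_comps _),
        constantCoeff_linForm]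
    simp [g, h0]
  · have hterm (h : H) : (χ h)⁻¹ • P (linCoeff (subst (comps (ψ h)) (linForm a))) = P a := by
      rw [linCoeff_subst_comps, linCoeff_linForm, ha, inv_smul_smul₀ (character_ne_zero χ h)]
    simp only [g, map_smul, map_sum, hterm, Finset.sum_const, Finset.card_univ]
    rw [← Nat.cast_smul_eq_nsmul ℂ, inv_smul_smul₀ hcard]
  · have hterm (h : H) : subst (comps (ψ k)) ((χ h)⁻¹ • subst (comps (ψ h)) (linForm a)) =
        χ k • (χ (h * k))⁻¹ • subst (comps (ψ (h * k))) (linForm a) := by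
      rw [subst_smul (hasSubst_comps _), ← subst_comps_mul, ← map_mul, smul_smul, map_mul χ,
        mul_inv, mul_left_comm, mul_inv_cancel₀ (character_ne_zero χ k), mul_one]
    have hsum : ∑ h, (χ (h * k))⁻¹ • subst (comps (ψ (h * k))) (linForm a) =
        ∑ h, (χ h)⁻¹ • subst (comps (ψ h)) (linForm a) :=
      Fintype.sum_equiv (Equiv.mulRight k) _ _ fun _ => rfl
    rw [subst_smul (hasSubst_comps _), ← substAlgHom_apply (hasSubst_comps (ψ k)), map_sum]
    simp only [substAlgHom_apply, hterm, ← Finset.smul_sum]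
    rw [hsum, smul_comm]

theorem exists_diagonalizing_coordinates [Finite H] [DecidableEq σ] (ψ : H →* FormalBihol σ)
    (χ : σ → H →* ℂ) {A : Matrix σ σ ℂ} (hA : IsUnit A)
    (hAψ : ∀ h, A * linearPart (ψ h) = diagonal (χ · h) * A) :
    ∃ U : FormalBihol σ, linearPart U = A ∧
      ∀ i h, subst (comps (ψ h)) (comps U i) = χ i h • comps U i := by
  have hrow (i : σ) (h : H) : A i ᵥ* linearPart (ψ h) = χ i h • A i := by
    rw [← mul_apply_eq_vecMul, hAψ]
    exact funext fun _ => diagonal_mul _ _ _ _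
  choose g hg0 hgA hgψ using fun i => exists_semiinvariant ψ (χ i) LinearMap.id (hrow i)
  have hA' : (of fun i => linCoeff (g i)) = A := funext hgA
  obtain ⟨U, rfl⟩ := exists_formalBihol_comps_eq hg0 (hA' ▸ hA)
  exact ⟨U, hA', hgψ⟩

theorem exists_fiberwise_diagonalizing_coordinates [Finite H] {p : ℕ}
    (ψ : H →* FormalBihol (ZW p)) (χ : Fin p → H →* ℂ) {A : Matrix (Fin p) (Fin p) ℂ}
    (hA : IsUnit A)
    (hAψ : ∀ h, A * (ψ h : FormalMap (ZW p)).wBlock = diagonal (χ · h) * A) :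
    ∃ U : FormalBihol (ZW p), (U : FormalMap (ZW p)).IsFiberwise ∧
      ∀ k h, subst (comps (ψ h)) (comps U (Sum.inr k)) = χ k h • comps U (Sum.inr k) := by
  let P : (ZW p → ℂ) →ₗ[ℂ] Fin p → ℂ := LinearMap.funLeft ℂ ℂ Sum.inr
  have hrow (k : Fin p) (h : H) :
      P (Sum.elim 0 (A k) ᵥ* linearPart (ψ h)) = χ k h • P (Sum.elim 0 (A k)) := by
    have hPA : P (Sum.elim 0 (A k) ᵥ* linearPart (ψ h)) =
        A k ᵥ* (ψ h : FormalMap (ZW p)).wBlock := by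
      ext l
      simp [P, vecMul, dotProduct, FormalMap.wBlock, toBlocks₂₂, linearPart_eq_jacobian]
    rw [hPA, ← mul_apply_eq_vecMul, hAψ]
    exact funext fun _ => diagonal_mul _ _ _ _
  choose g hg0 hgA hgψ using fun k => exists_semiinvariant ψ (χ k) P (hrow k)
  obtain ⟨U, hU⟩ := (FormalMap.isFiberwise_ofFiber g hg0).isUnit_iff_isUnit_wBlock.mpr
    (by rwa [show (FormalMap.ofFiber g hg0).wBlock = A from funext hgA])
  have hUg (k : Fin p) : comps U (Sum.inr k) = g k :=
    congrFun (congrArg FormalMap.toFun hU) (Sum.inr k)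
  refine ⟨U, hU ▸ FormalMap.isFiberwise_ofFiber g hg0, fun k h => ?_⟩
  rw [hUg, hgψ]

theorem eq_one_of_isOfFinOrder_of_linearPart_eq_one {σ : Type} [Finite σ] [DecidableEq σ]
    {g : FormalBihol σ} (hg : IsOfFinOrder g) (hlin : linearPart g = 1) : g = 1 := by
  cases nonempty_fintype σ
  have : Finite (Subgroup.zpowers g) := hg.finite_zpowers
  have hlin' (h : Subgroup.zpowers g) : linearPart (h : FormalBihol σ) = 1 := by
    have hker : g ∈ (jacobian.comp (Units.coeHom (FormalMap σ))).ker := hlin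
    exact Subgroup.zpowers_le.mpr hker h.2
  obtain ⟨U, -, hU⟩ := exists_diagonalizing_coordinates (Subgroup.zpowers g).subtype
    (fun _ => 1) isUnit_one fun h => by simp [hlin']
  have hUg : U * g = U := formalBihol_ext fun i =>
    (hU i ⟨g, Subgroup.mem_zpowers g⟩).trans (one_smul ℂ _)
  exact mul_eq_left.mp hUg

theorem FormalMap.IsFiberwise.eq_one_of_isOfFinOrder {p : ℕ} {g : FormalBihol (ZW p)}
    (hg : (g : FormalMap (ZW p)).IsFiberwise) (hfin : IsOfFinOrder g)
    (hw : (g : FormalMap (ZW p)).wBlock = 1) : g = 1 := by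
  refine eq_one_of_isOfFinOrder_of_linearPart_eq_one hfin ?_
  rw [linearPart_eq_jacobian]
  have hJ := hg.jacobian_eq_fromBlocks
  rw [hw] at hJ
  set C := (jacobian (g : FormalMap (ZW p))).toBlocks₂₁
  have hpow (n : ℕ) : jacobian (g : FormalMap (ZW p)) ^ n = fromBlocks 1 0 ((n : ℂ) • C) 1 := by
    induction n with
    | zero => rw [pow_zero, Nat.cast_zero, zero_smul, fromBlocks_one]
    | succ n ih => rw [pow_succ, ih, hJ, fromBlocks_multiply]; simp [add_smul]
  obtain ⟨n, hn, hgn⟩ := isOfFinOrder_iff_pow_eq_one.mp hfin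
  have hC : (n : ℂ) • C = 0 := by
    have h := hpow n
    rw [← map_pow, ← Units.val_pow_eq_pow_val, hgn, Units.val_one, map_one, ← fromBlocks_one] at h
    exact (fromBlocks_inj.mp h).2.2.1.symm
  rw [hJ, (smul_eq_zero.mp hC).resolve_left (Nat.cast_ne_zero.mpr hn.ne'), fromBlocks_one]

end Averaging

section LinearAlgebra

variable {K : Type*} [Field K]

section Diagonalization

variable [IsAlgClosed K] [CharZero K]

theorem span_common_eigenvectors_eq_top {V ι : Type*} [AddCommGroup V] [Module K V]
    [FiniteDimensional K V] {f : ι → Module.End K V} (hcomm : ∀ i j, Commute (f i) (f j))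
    (hfin : ∀ i, IsOfFinOrder (f i)) :
    Submodule.span K {v | ∀ i, ∃ c : K, f i v = c • v} = ⊤ := by
  have hss (i : ι) : (f i).IsFinitelySemisimple := by
    obtain ⟨n, hn, hfn⟩ := isOfFinOrder_iff_pow_eq_one.mp (hfin i)
    refine (Module.End.isSemisimple_of_squarefree_aeval_eq_zero (p := Polynomial.X ^ n - 1)
      (Polynomial.X_pow_sub_one_separable_iff.mpr
        (Nat.cast_ne_zero.mpr hn.ne')).squarefree ?_).isFinitelySemisimple
    simp [hfn]
  have htop : ⨆ c : ι → K, ⨅ i, (f i).maxGenEigenspace (c i) = ⊤ :=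
    Module.End.iSup_iInf_maxGenEigenspace_eq_top_of_iSup_maxGenEigenspace_eq_top_of_commute
      f (fun i j _ => hcomm i j) fun i => Module.End.iSup_maxGenEigenspace_eq_top (f i)
  rw [eq_top_iff, ← htop, iSup_le_iff]
  refine fun c v hv => Submodule.subset_span fun i => ⟨c i, ?_⟩
  rw [← Module.End.mem_eigenspace_iff, ← (hss i).maxGenEigenspace_eq_eigenspace]
  exact (Submodule.mem_iInf _).mp hv i

theorem mul_self_eq_one_of_isOfFinOrder {V : Type*} [AddCommGroup V] [Module K V]
    [FiniteDimensional K V] {f : Module.End K V} (hfin : IsOfFinOrder f)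
    (hf : ∀ c, f.HasEigenvalue c → c ^ 2 = 1) : f * f = 1 := by
  refine LinearMap.ext_on
    (span_common_eigenvectors_eq_top (f := fun _ : Unit => f) (fun _ _ => Commute.refl f)
      fun _ => hfin) fun v hv => ?_
  obtain ⟨c, hc⟩ := hv ()
  obtain rfl | hv0 := eq_or_ne v 0
  · rw [map_zero, map_zero]
  · have hc2 : c ^ 2 = 1 := hf c (Module.End.hasEigenvalue_of_hasEigenvector
      (Module.End.hasEigenvector_iff.mpr ⟨Module.End.mem_eigenspace_iff.mpr hc, hv0⟩))
    rw [Module.End.mul_apply, hc, map_smul, hc, smul_smul, ← sq, hc2, one_smul,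
      Module.End.one_apply]

theorem exists_mul_eq_diagonal_mul {H n : Type*} [Monoid H] [Fintype n] [DecidableEq n]
    (L : H →* Matrix n n K) (hcomm : ∀ g h, Commute (L g) (L h))
    (hfin : ∀ h, IsOfFinOrder (L h)) :
    ∃ (A : Matrix n n K) (χ : n → H →* K), IsUnit A ∧
      ∀ h, A * L h = diagonal (χ · h) * A := by
  let f (h : H) : Module.End K (n → K) := toLinAlgEquiv' (L h)ᵀ
  have hspan := span_common_eigenvectors_eq_top (f := f)
    (fun g h => by
      rw [commute_iff_eq, ← map_mul, ← map_mul, ← transpose_mul, ← transpose_mul, (hcomm h g).eq])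
    fun h => by
      obtain ⟨k, hk, hLk⟩ := isOfFinOrder_iff_pow_eq_one.mp (hfin h)
      refine isOfFinOrder_iff_pow_eq_one.mpr ⟨k, hk, ?_⟩
      rw [← map_pow, ← transpose_pow, hLk, transpose_one, map_one]
  obtain ⟨b, hbS, hbspan, hbli⟩ := exists_linearIndependent K {v | ∀ h, ∃ c : K, f h v = c • v}
  let B : Module.Basis b K (n → K) :=
    Module.Basis.mk hbli (by rw [Subtype.range_coe, hbspan, hspan])
  let e : b ≃ n := B.indexEquiv (Pi.basisFun K n)
  let A : Matrix n n K := of fun i => (e.symm i : n → K)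
  have hA : LinearIndependent K A.row := hbli.comp _ e.symm.injective
  choose c hc using fun i => hbS (e.symm i).2
  have hcA (i : n) (h : H) : A i ᵥ* L h = c i h • A i :=
    (mulVec_transpose _ _).symm.trans (hc i h)
  have hinj (i : n) : Function.Injective fun x : K => x • A i :=
    smul_left_injective K (hA.ne_zero i)
  let χ (i : n) : H →* K :=
    { toFun := c i
      map_one' := hinj i (by beta_reduce; rw [← hcA, map_one, vecMul_one, one_smul])
      map_mul' := fun g h => hinj i (by
        beta_reduce
        rw [← hcA, map_mul, ← vecMul_vecMul, hcA, smul_vecMul, hcA, smul_smul]) }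
  refine ⟨A, χ, linearIndependent_rows_iff_isUnit.mp hA, fun h => ?_⟩
  ext i j
  rw [diagonal_mul]
  exact congrFun (hcA i h) j

end Diagonalization

theorem eq_of_diagonal_eq_vecMulVec {n : Type*} [DecidableEq n] {d a b : n → K}
    (h : diagonal d = vecMulVec a b) {i j : n} (hi : d i ≠ 0) (hj : d j ≠ 0) : i = j := by
  by_contra hij
  have hentry (k l : n) : diagonal d k l = a k * b l := by rw [h, vecMulVec_apply]
  have hii := hentry i i
  have hjj := hentry j j
  have h0 := hentry i j
  rw [diagonal_apply_eq] at hii hjj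
  rw [diagonal_apply_ne _ hij] at h0
  exact mul_ne_zero (left_ne_zero_of_mul (hii ▸ hi)) (right_ne_zero_of_mul (hjj ▸ hj)) h0.symm

variable {σ : Type*} [Fintype σ] [DecidableEq σ]

/-- The subspace of `K^σ` on which the coordinates in `J` vanish. -/
def coordSubspace (K : Type*) [Field K] {σ : Type*} (J : Finset σ) : Submodule K (σ → K) :=
  ⨅ i ∈ (J : Set σ), LinearMap.ker (LinearMap.proj i)

theorem mem_coordSubspace {σ : Type*} {J : Finset σ} {v : σ → K} :
    v ∈ coordSubspace K J ↔ ∀ i ∈ J, v i = 0 := by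
  simp [coordSubspace]

theorem finrank_comap_coordSubspace {A : Matrix σ σ K} (hA : IsUnit A) (J : Finset σ) :
    Module.finrank K ((coordSubspace K J).comap (toLin' A)) + J.card = Fintype.card σ := by
  have hcoord : Module.finrank K (coordSubspace K J) = Jᶜ.card := by
    have e := LinearMap.iInfKerProjEquiv K (fun _ : σ => K) (I := ((Jᶜ : Finset σ) : Set σ))
      (J := (J : Set σ)) (by rw [Finset.disjoint_coe]; exact disjoint_compl_left)
      (by rw [← Finset.coe_union, Finset.union_comm, Finset.union_compl, Finset.coe_univ])
    rw [coordSubspace, e.finrank_eq, Module.finrank_fintype_fun_eq_card]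
    exact Fintype.card_coe Jᶜ
  let e : (σ → K) ≃ₗ[K] (σ → K) := LinearEquiv.ofBijective (toLin' A)
    ⟨mulVec_injective_iff_isUnit.mpr hA, mulVec_surjective_iff_isUnit.mpr hA⟩
  have hmap : ((coordSubspace K J).comap (toLin' A)).map (e : (σ → K) →ₗ[K] (σ → K)) =
      coordSubspace K J := Submodule.map_comap_eq_of_surjective e.surjective _
  rw [← hmap, LinearEquiv.finrank_map_eq] at hcoord
  rw [hcoord, Finset.card_compl_add_card]

theorem eqLocus_eq_comap_coordSubspace {A L : Matrix σ σ K} (hA : IsUnit A) {d : σ → K}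
    (hL : A * L = diagonal d * A) (J : Finset σ) (hJ : ∀ i, i ∈ J ↔ d i ≠ 1) :
    LinearMap.eqLocus (toLin' L) LinearMap.id = (coordSubspace K J).comap (toLin' A) := by
  ext v
  have hd (i : σ) : d i * (A *ᵥ v) i = (A *ᵥ v) i ↔ (d i ≠ 1 → (A *ᵥ v) i = 0) := by
    rw [mul_left_eq_self₀, or_iff_not_imp_left]
  simp only [LinearMap.mem_eqLocus, Submodule.mem_comap, mem_coordSubspace, LinearMap.id_apply,
    toLin'_apply, hJ]
  rw [← (mulVec_injective_iff_isUnit.mpr hA).eq_iff, mulVec_mulVec, hL, ← mulVec_mulVec,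
    funext_iff]
  simp only [mulVec_diagonal, hd]

end LinearAlgebra

section SignChanges

/-- The diagonal linear formal map `x ↦ (c_i x_i)`. -/
def FormalMap.scale {σ : Type} [Finite σ] : (σ → ℂ) →* FormalMap σ where
  toFun c := ⟨fun i => c i • X i, fun i => by simp⟩
  map_one' := FormalMap.ext (funext fun i => one_smul ℂ (X i))
  map_mul' c d := by
    refine FormalMap.ext (funext fun i => ?_)
    rw [FormalMap.mul_toFun, subst_smul (FormalMap.hasSubst _), subst_X (FormalMap.hasSubst _),
      smul_smul]
    rfl

variable {p : ℕ}

/-- The factors by which the sign change `(z', w') ↦ (z', s w')` scales the coordinates. -/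
def signVec : (Fin p → ℤˣ) →* (ZW p → ℂ) where
  toFun s := Sum.elim 1 fun k => ((s k : ℤ) : ℂ)
  map_one' := by ext (i | k) <;> simp
  map_mul' s t := by ext (i | k) <;> simp

theorem signVec_inl (s : Fin p → ℤˣ) (i : Fin p) : signVec s (Sum.inl i) = 1 := rfl

theorem signVec_inr (s : Fin p → ℤˣ) (k : Fin p) :
    signVec s (Sum.inr k) = ((s k : ℤ) : ℂ) := rfl

theorem signVec_injective : Function.Injective (signVec (p := p)) := fun s t hst => by
  ext k
  exact Int.cast_injective (α := ℂ) (congrFun hst (Sum.inr k))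

/-- The sign changes `(z', w') ↦ (z', s w')`. -/
def flip : (Fin p → ℤˣ) →* FormalBihol (ZW p) := (FormalMap.scale.comp signVec).toHomUnits

theorem comps_flip (s : Fin p → ℤˣ) : comps (flip s) = signVec s • X := rfl

theorem subst_comps_flip (s : Fin p → ℤˣ) (f : MvPowerSeries (ZW p) ℂ) :
    subst (comps (flip s)) f = rescale (signVec s) f := by
  rw [rescale_eq_subst, comps_flip]

theorem linearPart_flip (s : Fin p → ℤˣ) : linearPart (flip s) = diagonal (signVec s) := by
  ext i j
  rw [← linCoeff_comps, comps_flip, Pi.smul_apply', map_smul, linCoeff_X]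
  simp [diagonal_apply, Pi.single_apply, eq_comm]

theorem flip_injective : Function.Injective (flip (p := p)) := fun s t hst =>
  signVec_injective (diagonal_injective (by rw [← linearPart_flip, hst, linearPart_flip]))

theorem mul_eq_flip_mul_iff {U g : FormalBihol (ZW p)} {s : Fin p → ℤˣ} :
    U * g = flip s * U ↔
      ∀ i, subst (comps g) (comps U i) = signVec s i • comps U i := by
  have hU (i : ZW p) : comps (flip s * U) i = signVec s i • comps U i := by
    rw [comps_mul, comps_flip, Pi.smul_apply', subst_smul (hasSubst_comps U),
      subst_X (hasSubst_comps U)]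
  exact ⟨fun h i => by rw [← hU, ← h, comps_mul],
    fun h => formalBihol_ext fun i => by rw [hU, ← h, comps_mul]⟩

/-- The group of sign changes of `w'` in the coordinates `U`. -/
def conjFlip (U : FormalBihol (ZW p)) : (Fin p → ℤˣ) →* FormalBihol (ZW p) :=
  (MulAut.conj U⁻¹).toMonoidHom.comp flip

theorem conjFlip_apply (U : FormalBihol (ZW p)) (s : Fin p → ℤˣ) :
    conjFlip U s = U⁻¹ * flip s * U := by
  simp [conjFlip]

theorem conjFlip_injective (U : FormalBihol (ZW p)) : Function.Injective (conjFlip U) :=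
  (MulAut.conj U⁻¹).injective.comp flip_injective

theorem eq_conjFlip_iff {U g : FormalBihol (ZW p)} {s : Fin p → ℤˣ} :
    g = conjFlip U s ↔ U * g = flip s * U := by
  rw [conjFlip_apply, mul_assoc, eq_inv_mul_iff_mul_eq]

theorem conjFlip_mul_inv (U F : FormalBihol (ZW p)) :
    conjFlip (U * F⁻¹) = (MulAut.conj F).toMonoidHom.comp (conjFlip U) := by
  ext1 s
  simp only [conjFlip_apply, MonoidHom.comp_apply, MulEquiv.coe_toMonoidHom, MulAut.conj_apply,
    _root_.mul_inv_rev, inv_inv, mul_assoc]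

end SignChanges

namespace FormalSubmanifold

variable {p : ℕ} (M : FormalSubmanifold p)

theorem eval_q (j : Fin p) (w : Fin p → ℂ) :
    MvPolynomial.eval w (M.q j) = ∑ d ∈ (Finset.univ : Finset (Fin p)).finsuppAntidiag 2,
      coeff (Finsupp.mapDomain Sum.inr d) (M.E j) * ∏ i, w i ^ d i := by
  rw [q, map_sum]
  refine Finset.sum_congr rfl fun d _ => ?_
  rw [MvPolynomial.eval_monomial, Finsupp.prod_fintype _ _ (by simp)]

theorem eval_smul_q (j : Fin p) (c : ℂ) (w : Fin p → ℂ) :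
    MvPolynomial.eval (c • w) (M.q j) = c ^ 2 * MvPolynomial.eval w (M.q j) := by
  rw [eval_q, eval_q, Finset.mul_sum]
  refine Finset.sum_congr rfl fun d hd => ?_
  have hd2 : ∑ i, d i = 2 := (Finset.mem_finsuppAntidiag.mp hd).1
  simp only [Pi.smul_apply, smul_eq_mul, mul_pow, Finset.prod_mul_distrib,
    Finset.prod_pow_eq_pow_sum, hd2]
  ring

/-- The straight line `t ↦ (0, t w)`. -/
def line (w : Fin p → ℂ) : ZW p → MvPowerSeries Unit ℂ :=
  fun i => (Sum.elim 0 w : ZW p → ℂ) i • X ()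

theorem constantCoeff_line (w : Fin p → ℂ) (i : ZW p) : constantCoeff (line w i) = 0 := by
  simp [line]

theorem hasSubst_line (w : Fin p → ℂ) : HasSubst (line w) :=
  hasSubst_of_constantCoeff_zero (constantCoeff_line w)

theorem linCoeff_line (w : Fin p → ℂ) (i : ZW p) :
    linCoeff (line w i) = fun _ => (Sum.elim 0 w : ZW p → ℂ) i := by
  rw [line, map_smul, linCoeff_X]
  ext
  simp

theorem coeff_subst_line_E (j : Fin p) (w : Fin p → ℂ) :
    coeff (Finsupp.single () 2) (subst (line w) (M.E j)) = MvPolynomial.eval w (M.q j) := by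
  have hinl (d : Fin p →₀ ℕ) (i : Fin p) :
      Finsupp.mapDomain (Sum.inr : Fin p → ZW p) d (Sum.inl i) = 0 :=
    Finsupp.mapDomain_of_notMem_range _ _ (by simp)
  have hinr (d : Fin p →₀ ℕ) (k : Fin p) :
      Finsupp.mapDomain (Sum.inr : Fin p → ZW p) d (Sum.inr k) = d k :=
    Finsupp.mapDomain_apply Sum.inr_injective _ _
  unfold line
  rw [coeff_subst_smul_X, eval_q]
  refine (Finset.sum_of_injOn (Finsupp.mapDomain Sum.inr)
    (Finsupp.mapDomain_injective Sum.inr_injective).injOn (fun d hd => ?_)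
    (fun d hd hdr => ?_) fun d _ => ?_).symm
  · simpa [Finset.mem_finsuppAntidiag, hinl, hinr] using hd
  · obtain ⟨i, hi⟩ : ∃ i, d (Sum.inl i) ≠ 0 := by
      by_contra! hcon
      have hd' : d = Finsupp.mapDomain Sum.inr (d.comapDomain Sum.inr Sum.inr_injective.injOn) := by
        ext (i | k)
        · rw [hinl, hcon]
        · rw [hinr, Finsupp.comapDomain_apply]
      rw [hd', Finset.mem_finsuppAntidiag, Fintype.sum_sum_type] at hd
      simp only [hinl, hinr, Finset.sum_const_zero, zero_add] at hd
      exact hdr ⟨_, Finset.mem_finsuppAntidiag.mpr ⟨hd.1, Finset.subset_univ _⟩, hd'.symm⟩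
    rw [Finset.prod_eq_zero (Finset.mem_univ (Sum.inl i)) (by simp [hi]), mul_zero]
  · simp [Fintype.prod_sum_type, hinl, hinr]

theorem coeff_subst_E_of_linCoeff_eq (j : Fin p) {w : Fin p → ℂ} {a : ZW p → MvPowerSeries Unit ℂ}
    (ha : ∀ i, constantCoeff (a i) = 0)
    (haw : ∀ i, linCoeff (a i) = fun _ => (Sum.elim 0 w : ZW p → ℂ) i) :
    coeff (Finsupp.single () 2) (subst a (M.E j)) = MvPolynomial.eval w (M.q j) := by
  have hab (i : ZW p) : 2 ≤ (a i - line w i).order := by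
    refine two_le_order_iff.mpr ⟨?_, ?_⟩
    · rw [map_sub, ha, constantCoeff_line, sub_zero]
    · rw [map_sub, haw, linCoeff_line, sub_self]
  have h3 : ((2 + 1 : ℕ) : ℕ∞) ≤ (subst a (M.E j) - subst (line w) (M.E j)).order :=
    (add_le_add_left (M.two_le_order j) 1).trans
      (add_one_le_order_subst_sub_subst ha (constantCoeff_line w) hab _)
  rw [← M.coeff_subst_line_E, ← sub_eq_zero, ← map_sub]
  exact natCast_le_order_iff.mp h3 _ (by simp)

theorem linCoeff_subst_line {F : FormalMap (ZW p)} (hF : F.IsFiberwise) (w : Fin p → ℂ)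
    (i : ZW p) : linCoeff (subst (line w) (F.toFun i)) =
      fun _ => (Sum.elim 0 (F.wBlock *ᵥ w) : ZW p → ℂ) i := by
  have hJ : jacobian F *ᵥ (Sum.elim 0 w : ZW p → ℂ) =
      (Sum.elim 0 (F.wBlock *ᵥ w) : ZW p → ℂ) := by
    rw [hF.jacobian_eq_fromBlocks, fromBlocks_mulVec]
    simp
  rw [linCoeff_subst (constantCoeff_line w), ← hJ]
  ext
  simp only [linCoeff_line]
  rfl

section Deck

variable {M}

theorem isFiberwise_of_mem_deck {τ : FormalBihol (ZW p)} (hτ : τ ∈ M.deck) :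
    (τ : FormalMap (ZW p)).IsFiberwise := hτ.1

theorem eval_wBlock_mulVec_q {τ : FormalBihol (ZW p)} (hτ : τ ∈ M.deck) (j : Fin p)
    (w : Fin p → ℂ) : MvPolynomial.eval ((τ : FormalMap (ZW p)).wBlock *ᵥ w) (M.q j) =
      MvPolynomial.eval w (M.q j) := by
  have ha (i : ZW p) : constantCoeff (subst (line w) (comps τ i)) = 0 := by
    rw [constantCoeff_subst_of_constantCoeff_zero (hasSubst_line w) (constantCoeff_line w),
      constantCoeff_comps]
  rw [← M.coeff_subst_line_E j w, ← M.coeff_subst_E_of_linCoeff_eq j ha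
      (linCoeff_subst_line (isFiberwise_of_mem_deck hτ) w),
    ← subst_comp_subst_apply (hasSubst_comps τ) (hasSubst_line w), hτ.2]

variable (M) in
/-- The action of the deck transformations on the tangent space of the fiber `z' = 0`. -/
def wBlockHom : M.deck →* Matrix (Fin p) (Fin p) ℂ where
  toFun τ := ((τ : FormalBihol (ZW p)) : FormalMap (ZW p)).wBlock
  map_one' := FormalMap.wBlock_one
  map_mul' _ τ := FormalMap.IsFiberwise.wBlock_mul _ (isFiberwise_of_mem_deck τ.2)

theorem wBlockHom_mul_self (hM : M.ConditionB) [Finite M.deck] (τ : M.deck) :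
    M.wBlockHom τ * M.wBlockHom τ = 1 := by
  refine toLinAlgEquiv'.injective ?_
  rw [map_mul, map_one]
  have hfin : IsOfFinOrder (M.wBlockHom τ) := M.wBlockHom.isOfFinOrder (isOfFinOrder_of_finite τ)
  refine mul_self_eq_one_of_isOfFinOrder
    (MonoidHom.isOfFinOrder (toLinAlgEquiv' (R := ℂ) (n := Fin p)).toRingEquiv.toMonoidHom hfin)
    fun c hc => ?_
  obtain ⟨w, hw⟩ := hc.exists_hasEigenvector
  obtain ⟨j, hj⟩ : ∃ j, MvPolynomial.eval w (M.q j) ≠ 0 := by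
    by_contra! hcon
    exact hw.2 (hM w hcon)
  have hτw : M.wBlockHom τ *ᵥ w = c • w := hw.apply_eq_smul
  refine mul_right_cancel₀ hj ?_
  rw [one_mul, ← eval_smul_q, ← hτw]
  exact eval_wBlock_mulVec_q τ.2 j w

theorem deck_mul_self (hM : M.ConditionB) [Finite M.deck] (τ : M.deck) : τ * τ = 1 := by
  have hfin : IsOfFinOrder ((τ * τ : M.deck) : FormalBihol (ZW p)) :=
    M.deck.subtype.isOfFinOrder (isOfFinOrder_of_finite (τ * τ))
  exact Subtype.ext ((isFiberwise_of_mem_deck (τ * τ).2).eq_one_of_isOfFinOrder hfin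
    ((map_mul M.wBlockHom τ τ).trans (wBlockHom_mul_self hM τ)))

theorem exists_coordinates_deck_le_range_conjFlip (hM : M.ConditionB) [Finite M.deck] :
    ∃ U : FormalBihol (ZW p), (U : FormalMap (ZW p)).IsFiberwise ∧
      M.deck ≤ (conjFlip U).range := by
  have hsq := deck_mul_self hM
  have hord (g : M.deck) : orderOf g ∣ 2 := orderOf_dvd_of_pow_eq_one ((sq g).trans (hsq g))
  obtain ⟨A, χ, hA, hAχ⟩ := exists_mul_eq_diagonal_mul M.wBlockHom
    (fun g h => (Commute.of_orderOf_dvd_two hord g h).map M.wBlockHom)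
    fun h => M.wBlockHom.isOfFinOrder (isOfFinOrder_of_finite h)
  obtain ⟨U, hU, hUχ⟩ := exists_fiberwise_diagonalizing_coordinates M.deck.subtype χ hA hAχ
  have hsign (k : Fin p) (h : M.deck) : ∃ s : ℤˣ, ((s : ℤ) : ℂ) = χ k h := by
    rcases mul_self_eq_one_iff.mp (show χ k h * χ k h = 1 by rw [← map_mul, hsq, map_one])
      with h1 | h1
    · exact ⟨1, by simp [h1]⟩
    · exact ⟨-1, by simp [h1]⟩
  choose s hs using hsign
  refine ⟨U, hU, fun g hg => ⟨fun k => s k ⟨g, hg⟩, ?_⟩⟩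
  refine (eq_conjFlip_iff.mpr (mul_eq_flip_mul_iff.mpr ?_)).symm
  have hUinl (i : Fin p) : comps U (Sum.inl i) = X (Sum.inl i) := hU i
  rintro (i | k)
  · rw [hUinl, subst_X (hasSubst_comps g), hg.1, signVec_inl, one_smul]
  · rw [signVec_inr, hs]
    exact hUχ k ⟨g, hg⟩

theorem exists_coordinates_deck_eq_range_conjFlip (hM : M.ConditionD) :
    ∃ U : FormalBihol (ZW p), (U : FormalMap (ZW p)).IsFiberwise ∧
      M.deck = (conjFlip U).range := by
  have hfin : Finite M.deck := Nat.finite_of_card_ne_zero (by rw [hM.2]; positivity)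
  obtain ⟨U, hU, hle⟩ := exists_coordinates_deck_le_range_conjFlip hM.1
  have : Finite (conjFlip U).range := Set.finite_range (conjFlip U)
  refine ⟨U, hU, Subgroup.eq_of_le_of_card_ge hle ?_⟩
  calc Nat.card (conjFlip U).range ≤ Nat.card (Fin p → ℤˣ) := Finite.card_range_le (conjFlip U)
    _ = Nat.card M.deck := by rw [hM.2]; simp

end Deck

end FormalSubmanifold

section XDivides

variable {σ R : Type*} [CommRing R]

theorem X_dvd_iff_rescale_eq_zero [DecidableEq σ] {k : σ} {f : MvPowerSeries σ R} :
    X k ∣ f ↔ rescale (Function.update 1 k 0) f = 0 := by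
  rw [X_dvd_iff, MvPowerSeries.ext_iff]
  refine forall_congr' fun m => ?_
  rw [coeff_rescale, coeff_zero, Finsupp.prod]
  by_cases hm : m k = 0
  · rw [imp_iff_right hm, Finset.prod_eq_one, one_mul]
    intro i hi
    have hik : i ≠ k := fun hik => Finsupp.mem_support_iff.mp hi (hik ▸ hm)
    rw [Function.update_of_ne hik, Pi.one_apply, one_pow]
  · rw [Finset.prod_eq_zero (Finsupp.mem_support_iff.mpr hm), zero_mul]
    · exact iff_of_true (fun h => absurd h hm) rfl
    · rw [Function.update_self, zero_pow hm]

theorem X_dvd_of_X_dvd_pow [NoZeroDivisors R] {k : σ} {f : MvPowerSeries σ R} {n : ℕ}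
    (h : X k ∣ f ^ n) : X k ∣ f := by
  classical
  rw [X_dvd_iff_rescale_eq_zero, map_pow] at h
  exact X_dvd_iff_rescale_eq_zero.mpr (eq_zero_of_pow_eq_zero h)

end XDivides

section FixedPoints

section Finite

variable {σ : Type} [Finite σ]

theorem span_comps_sub_X_eq (F U : FormalBihol σ) :
    Ideal.span (Set.range fun i => comps F i - X i) =
      Ideal.span (Set.range fun i => subst (comps F) (comps U i) - comps U i) := by
  refine le_antisymm (Ideal.span_le.mpr ?_) (Ideal.span_le.mpr ?_)
  · rintro _ ⟨i, rfl⟩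
    have h := subst_sub_subst_mem_span (constantCoeff_comps (U * F)) (constantCoeff_comps U)
      (comps U⁻¹ i)
    rwa [← comps_mul, ← comps_mul, inv_mul_cancel_left, inv_mul_cancel] at h
  · rintro _ ⟨i, rfl⟩
    have h := subst_sub_subst_mem_span (constantCoeff_comps F) constantCoeff_X (comps U i)
    rwa [subst_self] at h

theorem comps_dvd_iff {U : FormalBihol σ} {k : σ} {f : MvPowerSeries σ ℂ} :
    comps U k ∣ f ↔ X k ∣ subst (comps U⁻¹) f := by
  rw [← substAlgHom_apply (R := ℂ) (hasSubst_comps U⁻¹)]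
  constructor
  · intro h
    simpa only [substAlgHom_apply, ← comps_mul, mul_inv_cancel, comps_one] using
      map_dvd (substAlgHom (R := ℂ) (hasSubst_comps U⁻¹)) h
  · intro h
    simpa only [substAlgHom_apply, ← subst_comps_mul, inv_mul_cancel, subst_comps_one,
      subst_X (hasSubst_comps U)] using map_dvd (substAlgHom (R := ℂ) (hasSubst_comps U)) h

theorem isRadical_span_comps (U : FormalBihol σ) (k : σ) :
    (Ideal.span {comps U k}).IsRadical := by
  rintro f ⟨n, hn⟩
  rw [Ideal.mem_span_singleton, comps_dvd_iff, subst_pow (hasSubst_comps _)] at hn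
  exact Ideal.mem_span_singleton.mpr (comps_dvd_iff.mpr (X_dvd_of_X_dvd_pow hn))

theorem linearPart_apply_ne_zero (F : FormalBihol σ) (i : σ) : linearPart F i ≠ 0 := by
  classical
  cases nonempty_fintype σ
  exact (linearIndependent_rows_iff_isUnit.mpr (isUnit_linearPart F)).ne_zero i

theorem fixIdeal_one : fixIdeal (1 : FormalBihol σ) = ⊥ := by
  have hspan : Ideal.span (Set.range fun i => comps (1 : FormalBihol σ) i - X i) = ⊥ := by
    simp [comps_one]
  rw [fixIdeal, hspan]
  exact (Ideal.isRadical_iff_quotient_reduced _).mpr inferInstance |>.radical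

end Finite

variable {σ : Type} [Fintype σ]

theorem differential_apply (r : MvPowerSeries σ ℂ) (v : σ → ℂ) :
    differential r v = linCoeff r ⬝ᵥ v := by
  simp [differential, dotProduct, linCoeff_apply]

theorem differential_ne_zero_iff {r : MvPowerSeries σ ℂ} :
    differential r ≠ 0 ↔ linCoeff r ≠ 0 := by
  rw [not_iff_not, ← dotProduct_eq_zero_iff]
  exact ⟨fun h v => by rw [← differential_apply, h, LinearMap.zero_apply],
    fun h => LinearMap.ext fun v => (differential_apply r v).trans (h v)⟩

theorem IsFormalHypersurface.ne_bot {I : Ideal (MvPowerSeries σ ℂ)}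
    (hI : IsFormalHypersurface I) : I ≠ ⊥ := by
  rintro rfl
  obtain ⟨r, hr, -, hr1⟩ := hI
  have hr0 : r = 0 := Ideal.span_singleton_eq_bot.mp hr.symm
  exact differential_ne_zero_iff.mp hr1 (by rw [hr0, map_zero])

variable [DecidableEq σ]

theorem exists_linearPart_sub_one_eq_vecMulVec {F : FormalBihol σ}
    (hF : IsFormalHypersurface (fixIdeal F)) : ∃ a b, linearPart F - 1 = vecMulVec a b := by
  obtain ⟨r, hr, hr0, -⟩ := hF
  have hdvd (i : σ) : r ∣ comps F i - X i := by
    rw [← Ideal.mem_span_singleton, ← hr]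
    exact Ideal.le_radical (Ideal.subset_span ⟨i, rfl⟩)
  choose c hc using hdvd
  refine ⟨fun i => constantCoeff (c i), linCoeff r, ?_⟩
  ext i k
  have h := congrFun (congrArg linCoeff (hc i)) k
  rw [map_sub, linCoeff_mul, hr0, zero_smul, zero_add, linCoeff_X, linCoeff_comps] at h
  simpa [one_apply, Pi.single_apply, eq_comm, vecMulVec_apply] using h

end FixedPoints

section Reflections

variable {p : ℕ}

/-- The sign change in the `j`-th coordinate. -/
def signAt (j : Fin p) : Fin p → ℤˣ := Pi.mulSingle j (-1)

theorem signAt_apply_ne_one_iff {j k : Fin p} : signAt j k ≠ 1 ↔ k = j := by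
  rw [signAt, Pi.mulSingle_apply]
  split_ifs with h <;> simp [h]

theorem signAt_injective : Function.Injective (signAt (p := p)) := fun j k h =>
  signAt_apply_ne_one_iff.mp (h ▸ signAt_apply_ne_one_iff.mpr rfl : signAt k j ≠ 1)

theorem exists_eq_signAt {s : Fin p → ℤˣ} (hs : s ≠ 1)
    (h : ∀ k l, s k ≠ 1 → s l ≠ 1 → k = l) : ∃ k, s = signAt k := by
  obtain ⟨k, hk⟩ := Function.ne_iff.mp hs
  refine ⟨k, funext fun l => ?_⟩
  obtain rfl | hlk := eq_or_ne l k
  · rw [signAt, Pi.mulSingle_eq_same]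
    exact (Int.units_eq_one_or _).resolve_left hk
  · rw [signAt, Pi.mulSingle_eq_of_ne hlk]
    by_contra hl
    exact hlk (h l k hl hk)

theorem closure_range_signAt : Subgroup.closure (Set.range (signAt (p := p))) = ⊤ := by
  refine eq_top_iff.mpr fun s _ => ?_
  rw [← Finset.univ_prod_mulSingle s]
  refine Subgroup.prod_mem _ fun j _ => ?_
  obtain h | h := Int.units_eq_one_or (s j)
  · rw [h, Pi.mulSingle_one]
    exact one_mem _
  · rw [h]
    exact Subgroup.subset_closure ⟨j, rfl⟩

/-- The sign changes of the single coordinates `w'_j` in the coordinates `U`. -/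
def reflections (U : FormalBihol (ZW p)) (j : Fin p) : FormalBihol (ZW p) :=
  conjFlip U (signAt j)

theorem reflections_injective (U : FormalBihol (ZW p)) : Function.Injective (reflections U) :=
  (conjFlip_injective U).comp signAt_injective

theorem closure_range_reflections (U : FormalBihol (ZW p)) :
    Subgroup.closure (Set.range (reflections U)) = (conjFlip U).range := by
  rw [MonoidHom.range_eq_map, ← closure_range_signAt, MonoidHom.map_closure, ← Set.range_comp]
  rfl

theorem fixIdeal_reflections (U : FormalBihol (ZW p)) (k : Fin p) :
    fixIdeal (reflections U k) = Ideal.span {comps U (Sum.inr k)} := by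
  have hgen (i : ZW p) : subst (comps (reflections U k)) (comps U i) - comps U i =
      (signVec (signAt k) i - 1) • comps U i := by
    have h : U * reflections U k = flip (signAt k) * U := eq_conjFlip_iff.mp rfl
    rw [mul_eq_flip_mul_iff.mp h, sub_smul, one_smul]
  rw [fixIdeal, span_comps_sub_X_eq _ U, ← (isRadical_span_comps U (Sum.inr k)).radical]
  congr 1
  simp only [hgen]
  refine le_antisymm (Ideal.span_le.mpr ?_) ?_
  · rintro _ ⟨i | l, rfl⟩
    · simp [signVec_inl]
    · by_cases hlk : l = k
      · rw [hlk]
        exact Submodule.smul_of_tower_mem _ _ (Ideal.mem_span_singleton_self _)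
      · simp [signVec_inr, signAt, hlk]
  · rw [Ideal.span_singleton_le_iff_mem]
    have h2 : signVec (signAt k) (Sum.inr k) - 1 = (-2 : ℂ) := by
      norm_num [signVec_inr, signAt]
    have hmem := Ideal.subset_span (α := MvPowerSeries (ZW p) ℂ)
      (Set.mem_range_self (f := fun i => (signVec (signAt k) i - 1) • comps U i) (Sum.inr k))
    have h := Submodule.smul_of_tower_mem _ (-2 : ℂ)⁻¹ hmem
    rwa [h2, inv_smul_smul₀ (by norm_num)] at h

theorem isFormalHypersurface_reflections (U : FormalBihol (ZW p)) (k : Fin p) :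
    IsFormalHypersurface (fixIdeal (reflections U k)) :=
  ⟨comps U (Sum.inr k), fixIdeal_reflections U k, constantCoeff_comps _ _,
    differential_ne_zero_iff.mpr (linearPart_apply_ne_zero U _)⟩

theorem exists_conjFlip_eq_reflections {U : FormalBihol (ZW p)} {s : Fin p → ℤˣ}
    (h : IsFormalHypersurface (fixIdeal (conjFlip U s))) : ∃ k, conjFlip U s = reflections U k := by
  have hs : s ≠ 1 := by
    rintro rfl
    exact h.ne_bot (by rw [map_one, fixIdeal_one])
  obtain ⟨a, b, hab⟩ := exists_linearPart_sub_one_eq_vecMulVec h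
  have hdiag : diagonal (signVec s - 1) =
      vecMulVec (linearPart U *ᵥ a) (b ᵥ* linearPart U⁻¹) := by
    have hflip : flip s = U * conjFlip U s * U⁻¹ := by
      rw [conjFlip_apply]
      group
    rw [← vecMulVec_mul, ← mul_vecMulVec, ← hab, mul_sub, sub_mul, ← linearPart_mul,
      ← linearPart_mul, ← hflip, mul_one, ← linearPart_mul, mul_inv_cancel, linearPart_one,
      linearPart_flip, ← diagonal_one, diagonal_sub]
    rfl
  have hne {k : Fin p} (hk : s k ≠ 1) : (signVec s - 1) (Sum.inr k) ≠ 0 := by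
    rw [Pi.sub_apply, Pi.one_apply, sub_ne_zero, signVec_inr]
    exact Int.cast_ne_one.mpr (mt Units.val_eq_one.mp hk)
  obtain ⟨k, rfl⟩ := exists_eq_signAt hs fun k l hk hl =>
    Sum.inr_injective (eq_of_diagonal_eq_vecMulVec hdiag (hne hk) (hne hl))
  exact ⟨k, rfl⟩

end Reflections

namespace FormalSubmanifold

variable {p : ℕ} {M : FormalSubmanifold p} {U : FormalBihol (ZW p)}

theorem isAssociatedFamily_reflections (hU : M.deck = (conjFlip U).range) :
    M.IsAssociatedFamily (reflections U) :=
  ⟨reflections_injective U, by rw [closure_range_reflections, hU],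
    isFormalHypersurface_reflections U⟩

theorem IsAssociatedFamily.exists_eq_reflections_comp (hU : M.deck = (conjFlip U).range)
    {τ : Fin p → FormalBihol (ZW p)} (hτ : M.IsAssociatedFamily τ) :
    ∃ e : Equiv.Perm (Fin p), τ = reflections U ∘ e := by
  obtain ⟨hinj, hcl, hfix⟩ := hτ
  have hrefl (j : Fin p) : ∃ k, τ j = reflections U k := by
    have hj : τ j ∈ (conjFlip U).range := by
      rw [← hU, ← hcl]
      exact Subgroup.subset_closure ⟨j, rfl⟩
    obtain ⟨s, hs⟩ := hj
    rw [← hs]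
    exact exists_conjFlip_eq_reflections (hs ▸ hfix j)
  choose e he using hrefl
  have he_inj : Function.Injective e := fun i j hij => hinj (by rw [he, he, hij])
  exact ⟨Equiv.ofBijective e (Finite.injective_iff_bijective.mp he_inj), funext he⟩

theorem existsUnique_associatedFamily (hM : M.ConditionD) :
    ∃ τ : Fin p → FormalBihol (ZW p), M.IsAssociatedFamily τ ∧
      ∀ τ' : Fin p → FormalBihol (ZW p), M.IsAssociatedFamily τ' →
        Set.range τ' = Set.range τ := by
  obtain ⟨U, -, hU⟩ := exists_coordinates_deck_eq_range_conjFlip hM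
  refine ⟨reflections U, isAssociatedFamily_reflections hU, fun τ' hτ' => ?_⟩
  obtain ⟨e, rfl⟩ := hτ'.exists_eq_reflections_comp hU
  exact e.surjective.range_comp _

end FormalSubmanifold

section PowerSubstitution

variable {σ R : Type*} [CommRing R]

theorem coeff_single_two_sq (k : σ) {f : MvPowerSeries σ R} (hf : constantCoeff f = 0) :
    coeff (Finsupp.single k 2) (f ^ 2) = linCoeff f k ^ 2 := by
  classical
  simp [sq, coeff_mul, Finsupp.antidiagonal_single, Finset.Nat.antidiagonal_succ, hf,
    linCoeff_apply]

variable {m : σ → ℕ}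

theorem exponent_smul_injective (hm : ∀ i, m i ≠ 0) :
    Function.Injective fun d : σ →₀ ℕ => m • d := fun _ _ h =>
  Finsupp.ext fun i => Nat.eq_of_mul_eq_mul_left (Nat.pos_of_ne_zero (hm i))
    (DFunLike.congr_fun h i)

variable [Finite σ]

theorem hasSubst_X_pow (hm : ∀ i, m i ≠ 0) :
    HasSubst fun i => (X i ^ m i : MvPowerSeries σ R) :=
  hasSubst_of_constantCoeff_zero fun i => by simp [hm i]

theorem prod_X_pow_pow (d : σ →₀ ℕ) :
    (d.prod fun i n => (X i ^ m i : MvPowerSeries σ R) ^ n) = monomial (m • d) 1 := by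
  cases nonempty_fintype σ
  rw [monomial_one_eq, Finsupp.prod_fintype _ _ (by simp), Finsupp.prod_fintype _ _ (by simp)]
  exact Finset.prod_congr rfl fun i _ => (pow_mul _ _ _).symm

theorem coeff_smul_subst_X_pow (hm : ∀ i, m i ≠ 0) (g : MvPowerSeries σ R) (d : σ →₀ ℕ) :
    coeff (m • d) (subst (fun i => (X i ^ m i : MvPowerSeries σ R)) g) = coeff d g := by
  classical
  rw [coeff_subst (hasSubst_X_pow hm), finsum_eq_single _ d]
  · rw [prod_X_pow_pow, coeff_monomial_same, smul_eq_mul, mul_one]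
  · intro e hed
    rw [prod_X_pow_pow, coeff_monomial_ne fun h => hed (exponent_smul_injective hm h).symm,
      smul_zero]

theorem coeff_subst_X_pow_of_forall_ne (hm : ∀ i, m i ≠ 0) (g : MvPowerSeries σ R) {c : σ →₀ ℕ}
    (hc : ∀ d : σ →₀ ℕ, c ≠ m • d) :
    coeff c (subst (fun i => (X i ^ m i : MvPowerSeries σ R)) g) = 0 := by
  classical
  rw [coeff_subst (hasSubst_X_pow hm), finsum_eq_zero_of_forall_eq_zero]
  intro d
  rw [prod_X_pow_pow, coeff_monomial_ne (hc d), smul_zero]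

theorem subst_X_pow_injective (hm : ∀ i, m i ≠ 0) :
    Function.Injective (subst fun i => (X i ^ m i : MvPowerSeries σ R) :
      MvPowerSeries σ R → MvPowerSeries σ R) := fun f g h => by
  ext d
  rw [← coeff_smul_subst_X_pow hm f, ← coeff_smul_subst_X_pow hm g]
  exact congrArg (coeff (m • d)) h

theorem exists_eq_subst_X_pow (hm : ∀ i, m i ≠ 0) {f : MvPowerSeries σ R}
    (hf : ∀ d, coeff d f ≠ 0 → ∀ i, m i ∣ d i) :
    ∃ g : MvPowerSeries σ R, f = subst (fun i => X i ^ m i) g := by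
  let g : MvPowerSeries σ R := fun d => coeff (m • d) f
  refine ⟨g, MvPowerSeries.ext fun c => ?_⟩
  by_cases hc : ∃ d : σ →₀ ℕ, c = m • d
  · obtain ⟨d, rfl⟩ := hc
    exact (coeff_smul_subst_X_pow hm g d).symm
  · rw [coeff_subst_X_pow_of_forall_ne hm g (not_exists.mp hc)]
    by_contra hfc
    refine hc ⟨Finsupp.equivFunOnFinite.symm fun i => c i / m i, ?_⟩
    ext i
    exact (Nat.mul_div_cancel' (hf c hfc i)).symm

end PowerSubstitution

section SquareMap

variable {p : ℕ}

/-- The exponents of the monomials `(z', w'²)`. -/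
def squareExponent : ZW p → ℕ := Sum.elim 1 2

theorem squareExponent_ne_zero : ∀ i : ZW p, squareExponent i ≠ 0 := by
  rintro (_ | _) <;> simp [squareExponent]

/-- The map `(z', w') ↦ (z', w'₁², …, w'ₚ²)`. -/
def squareMap (p : ℕ) : FormalMap (ZW p) where
  toFun i := X i ^ squareExponent i
  map_zero i := by simp [squareExponent_ne_zero i]

theorem mul_squareMap_cancel {F G : FormalMap (ZW p)} (h : F * squareMap p = G * squareMap p) :
    F = G :=
  FormalMap.ext (funext fun i => subst_X_pow_injective squareExponent_ne_zero
    (congrFun (congrArg FormalMap.toFun h) i))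

theorem isFiberwise_squareMap : (squareMap p).IsFiberwise := fun _ => pow_one _

theorem squareMap_mul_flip (s : Fin p → ℤˣ) :
    squareMap p * (flip s : FormalMap (ZW p)) = squareMap p := by
  refine FormalMap.ext (funext fun i => ?_)
  have hs : signVec s i ^ squareExponent i = 1 := by
    rcases i with i | k
    · simp [signVec_inl]
    · simp [signVec_inr, squareExponent, ← Int.cast_pow, ← Units.val_pow_eq_pow_val]
  change subst (comps (flip s)) (X i ^ squareExponent i) = X i ^ squareExponent i
  rw [subst_pow (hasSubst_comps _), subst_X (hasSubst_comps _), comps_flip, Pi.smul_apply',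
    smul_pow, hs, one_smul]

theorem squareExponent_dvd {f : MvPowerSeries (ZW p) ℂ}
    (hf : ∀ s, subst (comps (flip s)) f = f) {d : ZW p →₀ ℕ} (hd : coeff d f ≠ 0) (i : ZW p) :
    squareExponent i ∣ d i := by
  rcases i with i | k
  · exact one_dvd _
  have h := congrArg (coeff d) (hf (signAt k))
  rw [subst_comps_flip, coeff_rescale, mul_eq_right₀ hd, Finsupp.prod_fintype _ _ (by simp),
    Finset.prod_eq_single (Sum.inr k), signVec_inr, signAt, Pi.mulSingle_eq_same] at h
  · rw [Units.val_neg, Units.val_one, Int.cast_neg, Int.cast_one] at h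
    exact ((neg_one_pow_eq_one_iff_even (by norm_num)).mp h).two_dvd
  · rintro (j | l) - hl
    · rw [signVec_inl, one_pow]
    · rw [signVec_inr, signAt, Pi.mulSingle_eq_of_ne fun h => hl (congrArg Sum.inr h)]
      simp
  · simp

theorem exists_eq_mul_squareMap {F : FormalMap (ZW p)}
    (hF : ∀ s : Fin p → ℤˣ, F * (flip s : FormalMap (ZW p)) = F) : ∃ G, F = G * squareMap p := by
  have heven (i : ZW p) (s : Fin p → ℤˣ) : subst (comps (flip s)) (F.toFun i) = F.toFun i :=
    congrFun (congrArg FormalMap.toFun (hF s)) i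
  choose g hg using fun i => exists_eq_subst_X_pow squareExponent_ne_zero
    fun d hd => squareExponent_dvd (heven i) hd
  refine ⟨⟨g, fun i => ?_⟩, FormalMap.ext (funext hg)⟩
  rw [← F.map_zero i, hg]
  exact (constantCoeff_subst_of_constantCoeff_zero (squareMap p).hasSubst
    (squareMap p).map_zero _).symm

theorem exists_eq_mul_squareMap_mul {F : FormalMap (ZW p)} {U : FormalBihol (ZW p)}
    (hF : ∀ s, F * (conjFlip U s : FormalMap (ZW p)) = F) :
    ∃ G, F = G * squareMap p * (U : FormalMap (ZW p)) := by
  have hFU (s : Fin p → ℤˣ) : F * (↑U⁻¹ : FormalMap (ZW p)) * (flip s : FormalMap (ZW p)) =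
      F * (↑U⁻¹ : FormalMap (ZW p)) := by
    have h := hF s
    rw [conjFlip_apply, Units.val_mul, Units.val_mul, ← mul_assoc, ← mul_assoc] at h
    rw [Units.eq_mul_inv_iff_mul_eq, h]
  obtain ⟨G, hG⟩ := exists_eq_mul_squareMap hFU
  exact ⟨G, by rw [← hG, Units.inv_mul_cancel_right]⟩

end SquareMap

section Fiberwise

variable {p : ℕ}

theorem FormalMap.IsFiberwise.mul {F G : FormalMap (ZW p)} (hF : F.IsFiberwise)
    (hG : G.IsFiberwise) : (F * G).IsFiberwise := fun i => by
  rw [FormalMap.mul_toFun, hF, subst_X G.hasSubst, hG]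

theorem FormalMap.IsFiberwise.inv {U : FormalBihol (ZW p)}
    (hU : (U : FormalMap (ZW p)).IsFiberwise) : (↑U⁻¹ : FormalMap (ZW p)).IsFiberwise := fun i => by
  have h : comps (U * U⁻¹) (Sum.inl i) = X (Sum.inl i) := by rw [mul_inv_cancel, comps_one]
  rwa [comps_mul, show comps U (Sum.inl i) = X (Sum.inl i) from hU i,
    subst_X (hasSubst_comps _)] at h

theorem FormalMap.IsFiberwise.of_mul_squareMap_mul {F : FormalMap (ZW p)} {U : FormalBihol (ZW p)}
    (hU : (U : FormalMap (ZW p)).IsFiberwise)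
    (h : (F * squareMap p * (U : FormalMap (ZW p))).IsFiberwise) : F.IsFiberwise := fun i => by
  have hFs : (F * squareMap p).IsFiberwise := by
    rw [← Units.mul_inv_cancel_right (F * squareMap p) U]
    exact h.mul hU.inv
  refine subst_X_pow_injective squareExponent_ne_zero ?_
  exact (hFs i).trans ((isFiberwise_squareMap i).symm.trans
    (subst_X (squareMap p).hasSubst (R := ℂ) (Sum.inl i)).symm)

end Fiberwise

namespace FormalSubmanifold

variable {p : ℕ} {M : FormalSubmanifold p}

variable (M) in
/-- The map `(z', w') ↦ (z', E(z', w'))`, which parametrizes `M` when `w'` is the conjugate of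
`z'`. -/
def param : FormalMap (ZW p) :=
  FormalMap.ofFiber M.E fun j => one_le_order_iff_constCoeff_eq_zero.mp
    (one_le_two.trans (M.two_le_order j))

theorem mem_deck_iff {τ : FormalBihol (ZW p)} :
    τ ∈ M.deck ↔ M.param * (τ : FormalMap (ZW p)) = M.param := by
  have hinl (i : Fin p) :
      (M.param * (τ : FormalMap (ZW p))).toFun (Sum.inl i) = comps τ (Sum.inl i) :=
    subst_X (hasSubst_comps τ) (R := ℂ) _
  constructor
  · rintro ⟨hτ, hE⟩
    exact FormalMap.ext (funext (Sum.rec (fun i => (hinl i).trans (hτ i)) hE))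
  · intro h
    have h' := congrFun (congrArg FormalMap.toFun h)
    exact ⟨fun i => (hinl i).symm.trans (h' (Sum.inl i)), fun j => h' (Sum.inr j)⟩

theorem eval_q_of_param_eq {e : FormalMap (ZW p)} {U : FormalMap (ZW p)} (hU : U.IsFiberwise)
    (h : M.param = e * squareMap p * U) (j : Fin p) (w : Fin p → ℂ) :
    MvPolynomial.eval w (M.q j) = (e.wBlock *ᵥ fun k => (U.wBlock *ᵥ w) k ^ 2) j := by
  let b (i : ZW p) : MvPowerSeries Unit ℂ := subst (line w) (U.toFun i) ^ squareExponent i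
  have hU0 (i : ZW p) : constantCoeff (subst (line w) (U.toFun i)) = 0 := by
    rw [constantCoeff_subst_of_constantCoeff_zero (hasSubst_line w) (constantCoeff_line w),
      U.map_zero]
  have hb_inl (i : Fin p) : b (Sum.inl i) = 0 := by
    have hU_inl : subst (line w) (U.toFun (Sum.inl i)) = 0 := by
      rw [hU, subst_X (hasSubst_line w), line, Sum.elim_inl, Pi.zero_apply, zero_smul]
    exact (pow_one _).trans hU_inl
  have hb_inr (k : Fin p) :
      coeff (Finsupp.single () 2) (b (Sum.inr k)) = (U.wBlock *ᵥ w) k ^ 2 := by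
    refine (coeff_single_two_sq () (hU0 _)).trans ?_
    rw [linCoeff_subst_line hU, Sum.elim_inr]
  have hb_order (i : ZW p) : ((2 : ℕ) : ℕ∞) ≤ (b i).order := by
    rcases i with i | k
    · rw [hb_inl, order_zero]
      exact le_top
    · exact le_order_pow_of_constantCoeff_eq_zero 2 (hU0 _)
  have hE : subst (line w) (M.E j) = subst b (e.toFun (Sum.inr j)) := by
    have hEj : M.E j = subst U.toFun (subst (squareMap p).toFun (e.toFun (Sum.inr j))) :=
      congrFun (congrArg FormalMap.toFun h) (Sum.inr j)
    rw [hEj, subst_comp_subst_apply U.hasSubst (hasSubst_line w),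
      subst_comp_subst_apply (squareMap p).hasSubst (hasSubst_of_constantCoeff_zero hU0)]
    congr 1
    funext i
    simp only [squareMap, b]
    rw [subst_pow (hasSubst_of_constantCoeff_zero hU0),
      subst_X (hasSubst_of_constantCoeff_zero hU0)]
  rw [← M.coeff_subst_line_E, hE, coeff_subst_of_degree_lt two_ne_zero hb_order _ (by simp)
    (by simp), Fintype.sum_sum_type]
  simp only [hb_inl, hb_inr, map_zero, mul_zero, Finset.sum_const_zero, zero_add]
  rfl

theorem isUnit_of_param_eq (hM : M.ConditionB) {e : FormalMap (ZW p)} {U : FormalBihol (ZW p)}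
    (hU : (U : FormalMap (ZW p)).IsFiberwise) (h : M.param = e * squareMap p * U) : IsUnit e := by
  have he : e.IsFiberwise :=
    FormalMap.IsFiberwise.of_mul_squareMap_mul hU (h ▸ FormalMap.isFiberwise_ofFiber _ _)
  have hUw := hU.isUnit_iff_isUnit_wBlock.mp U.isUnit
  rw [he.isUnit_iff_isUnit_wBlock, ← mulVec_injective_iff_isUnit]
  refine (injective_iff_map_eq_zero e.wBlock.mulVecLin).mpr fun s hs => ?_
  choose y hy using fun k => IsAlgClosed.exists_pow_nat_eq (s k) two_pos
  obtain ⟨w, rfl⟩ := mulVec_surjective_iff_isUnit.mpr hUw y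
  have hw : w = 0 := hM w fun j => by
    rw [eval_q_of_param_eq hU h, funext hy]
    exact congrFun hs j
  ext k
  rw [← hy k, hw, mulVec_zero, Pi.zero_apply, zero_pow two_ne_zero]

theorem exists_param_eq (hM : M.ConditionD) : ∃ e U : FormalBihol (ZW p),
    M.deck = (conjFlip U).range ∧ M.param = e * squareMap p * U := by
  obtain ⟨U, hU, hdeck⟩ := exists_coordinates_deck_eq_range_conjFlip hM
  have hs (s : Fin p → ℤˣ) : conjFlip U s ∈ M.deck := hdeck ▸ ⟨s, rfl⟩
  obtain ⟨e, he⟩ := exists_eq_mul_squareMap_mul fun s => mem_deck_iff.mp (hs s)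
  obtain ⟨e, rfl⟩ := isUnit_of_param_eq hM.1 hU he
  exact ⟨e, U, hdeck, he⟩

theorem mul_param_cancel (hM : M.ConditionD) {F G : FormalMap (ZW p)}
    (h : F * M.param = G * M.param) : F = G := by
  obtain ⟨e, U, -, he⟩ := exists_param_eq hM
  rw [he, ← mul_assoc, ← mul_assoc, ← mul_assoc, ← mul_assoc, Units.mul_left_inj] at h
  exact (Units.mul_left_inj e).mp (mul_squareMap_cancel h)

theorem exists_eq_mul_param (hM : M.ConditionD) {F : FormalMap (ZW p)}
    (hF : ∀ τ ∈ M.deck, F * (τ : FormalMap (ZW p)) = F) : ∃ f, F = f * M.param := by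
  obtain ⟨e, U, hdeck, he⟩ := exists_param_eq hM
  have hs (s : Fin p → ℤˣ) : conjFlip U s ∈ M.deck := hdeck ▸ ⟨s, rfl⟩
  obtain ⟨G, hG⟩ := exists_eq_mul_squareMap_mul fun s => hF _ (hs s)
  refine ⟨G * ↑e⁻¹, ?_⟩
  rw [he, mul_assoc, mul_assoc, Units.inv_mul_cancel_left, ← mul_assoc, hG]

end FormalSubmanifold

section Reality

variable {p : ℕ} {F G : FormalMap (ZW p)}

theorem FormalMap.bar_bar (F : FormalMap (ZW p)) : F.bar.bar = F :=
  FormalMap.ext (funext fun _ => MvPowerSeries.ext fun _ => Complex.conj_conj _)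

theorem bar_swap : FormalMap.bar (swap p) = swap p :=
  FormalMap.ext (funext fun i => MvPowerSeries.map_X _ i.swap)

theorem swap_mul_toFun (F : FormalMap (ZW p)) (i : ZW p) :
    (swap p * F).toFun i = F.toFun i.swap :=
  subst_X (R := ℂ) F.hasSubst i.swap

/-- Formal maps that commute with `ρ₀`; they are the complexifications of the real formal maps
`z' ↦ g(z', \bar z')` of `ℂ^p = ℝ^{2p}`. -/
def FormalMap.IsReal (F : FormalMap (ZW p)) : Prop := F * swap p = swap p * F.bar

namespace FormalMap.IsReal

theorem bar_mul_swap (hF : F.IsReal) : F.bar * swap p = swap p * F := by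
  have h := congrArg FormalMap.bar hF
  rwa [map_mul, map_mul, F.bar_bar, bar_swap] at h

theorem one : (1 : FormalMap (ZW p)).IsReal := by
  rw [IsReal, one_mul, map_one, mul_one]

theorem mul (hF : F.IsReal) (hG : G.IsReal) : (F * G).IsReal := by
  rw [IsReal, mul_assoc, hG, ← mul_assoc, hF, map_mul, mul_assoc]

theorem toFun_inr (hF : F.IsReal) (i : Fin p) :
    F.toFun (Sum.inr i) = (F.bar * swap p).toFun (Sum.inl i) := by
  rw [hF.bar_mul_swap, swap_mul_toFun, Sum.swap_inl]

theorem ext (hF : F.IsReal) (hG : G.IsReal)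
    (h : ∀ i, F.toFun (Sum.inl i) = G.toFun (Sum.inl i)) : F = G := by
  refine FormalMap.ext (funext ?_)
  rintro (i | i)
  · exact h i
  · rw [hF.toFun_inr, hG.toFun_inr]
    change subst _ (conj (F.toFun (Sum.inl i))) = subst _ (conj (G.toFun (Sum.inl i)))
    rw [h]

end FormalMap.IsReal

/-- The real map with the same `z'`-components as `F`. -/
def FormalMap.realify (F : FormalMap (ZW p)) : FormalMap (ZW p) where
  toFun := Sum.elim (fun i => F.toFun (Sum.inl i)) fun i => (F.bar * swap p).toFun (Sum.inl i)
  map_zero := by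
    rintro (i | i)
    · exact F.map_zero _
    · exact FormalMap.map_zero _ _

theorem FormalMap.isReal_of_toFun_inr
    (h : ∀ i, F.toFun (Sum.inr i) = (F.bar * swap p).toFun (Sum.inl i)) : F.IsReal := by
  refine FormalMap.ext (funext ?_)
  rintro (i | i)
  · rw [swap_mul_toFun]
    change _ = conj (F.toFun (Sum.inr i))
    rw [h]
    change _ = (F.bar * swap p).bar.toFun (Sum.inl i)
    rw [map_mul, F.bar_bar, bar_swap]
  · rw [swap_mul_toFun, FormalMap.mul_toFun, h, ← FormalMap.mul_toFun, mul_assoc, swap_mul_swap,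
      mul_one, Sum.swap_inr]

theorem FormalMap.isReal_realify (F : FormalMap (ZW p)) : F.realify.IsReal :=
  FormalMap.isReal_of_toFun_inr fun _ => rfl

theorem intertwines_rho0_iff {F : FormalBihol (ZW p)} :
    Intertwines F (rho0 p) (rho0 p) ↔ (F : FormalMap (ZW p)).IsReal :=
  Units.ext_iff

theorem FormalMap.IsReal.inv {F : FormalBihol (ZW p)} (hF : (F : FormalMap (ZW p)).IsReal) :
    (↑F⁻¹ : FormalMap (ZW p)).IsReal := by
  rw [← intertwines_rho0_iff, Intertwines] at hF ⊢
  rw [map_inv, inv_mul_eq_iff_eq_mul, ← mul_assoc, hF, mul_inv_cancel_right]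

end Reality

section SubstX

variable {σ τ υ R : Type*} [CommRing R] [Finite σ]

theorem hasSubst_X_comp (g : σ → τ) : HasSubst (fun i => X (g i) : σ → MvPowerSeries τ R) :=
  hasSubst_of_constantCoeff_zero fun _ => constantCoeff_X _

theorem subst_subst_X_comp {a : τ → MvPowerSeries υ R} (ha : HasSubst a) (g : σ → τ)
    (f : MvPowerSeries σ R) :
    subst a (subst (fun i => X (g i) : σ → MvPowerSeries τ R) f) = subst (fun i => a (g i)) f := by
  simp only [subst_comp_subst_apply (hasSubst_X_comp g) ha, subst_X ha]

end SubstX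

namespace FormalSubmanifold

variable {p : ℕ}

/-- The complexification `(z', w') ↦ (F(z', w'), \bar F(w', z'))` of a real parametrization
`z = F(z', \bar z')`. -/
def pairing (F : FormalMap (ZW p)) : Ambient p → MvPowerSeries (ZW p) ℂ :=
  Sum.elim F.toFun (F.bar * swap p).toFun

theorem constantCoeff_pairing (F : FormalMap (ZW p)) (i : Ambient p) :
    constantCoeff (pairing F i) = 0 := by
  rcases i with i | i
  · exact F.map_zero i
  · exact FormalMap.map_zero _ i

theorem hasSubst_pairing (F : FormalMap (ZW p)) : HasSubst (pairing F) :=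
  hasSubst_of_constantCoeff_zero (constantCoeff_pairing F)

theorem hasSubst_complexify (f : FormalBihol (Fin p ⊕ Fin p)) : HasSubst (complexify f) := by
  refine hasSubst_of_constantCoeff_zero ?_
  rintro (i | i)
  · exact constantCoeff_subst_eq_zero (hasSubst_X_comp _) (fun _ => constantCoeff_X _)
      (constantCoeff_comps f i)
  · exact constantCoeff_subst_eq_zero (hasSubst_X_comp _) (fun _ => constantCoeff_X _)
      ((FormalMap.bar (f : FormalMap (ZW p))).map_zero i)

theorem subst_pairing_complexify (f : FormalBihol (Fin p ⊕ Fin p)) (F : FormalMap (ZW p))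
    (r : MvPowerSeries (Ambient p) ℂ) :
    subst (pairing F) (subst (complexify f) r) =
      subst (pairing ((f : FormalMap (ZW p)) * F)) r := by
  rw [subst_comp_subst_apply (hasSubst_complexify f) (hasSubst_pairing F)]
  congr 1
  ext1 i
  rcases i with i | i
  · exact subst_subst_X_comp (hasSubst_pairing F) _ _
  · refine (subst_subst_X_comp (hasSubst_pairing F) _ _).trans ?_
    change (FormalMap.bar (f : FormalMap (ZW p)) * (F.bar * swap p)).toFun i = _
    rw [← mul_assoc, ← map_mul]
    rfl

theorem subst_pairing_mul (F : FormalMap (ZW p)) {G : FormalMap (ZW p)} (hG : G.IsReal)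
    (r : MvPowerSeries (Ambient p) ℂ) :
    subst (pairing (F * G)) r = subst G.toFun (subst (pairing F) r) := by
  rw [subst_comp_subst_apply (hasSubst_pairing F) G.hasSubst]
  congr 1
  ext1 i
  rcases i with i | i
  · rfl
  · change ((F * G).bar * swap p).toFun i = (F.bar * swap p * G).toFun i
    rw [map_mul, mul_assoc, hG.bar_mul_swap, mul_assoc]

/-- The embedding of the variables `(z', w')` into those of the ambient space. -/
def incl (p : ℕ) : ZW p → Ambient p :=
  Sum.elim (fun i => Sum.inl (Sum.inl i)) fun i => Sum.inr (Sum.inl i)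

variable (M : FormalSubmanifold p)

theorem pairing_param_incl (i : ZW p) : pairing M.param (incl p i) = X i := by
  rcases i with i | i
  · rfl
  · change subst (swap p).toFun (conj (X (Sum.inl i))) = _
    rw [conj, MvPowerSeries.map_X, subst_X (swap p).hasSubst]
    rfl

/-- The `i`-th component of the parametrization of `M`, as a power series on the ambient space. -/
def ambientParam (i : Ambient p) : MvPowerSeries (Ambient p) ℂ :=
  subst (fun k => X (incl p k) : ZW p → MvPowerSeries (Ambient p) ℂ) (pairing M.param i)

theorem ambientParam_incl (i : ZW p) : M.ambientParam (incl p i) = X (incl p i) := by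
  rw [ambientParam, pairing_param_incl, subst_X (hasSubst_X_comp (incl p))]

theorem ambientParam_inl_inr (j : Fin p) : M.ambientParam (Sum.inl (Sum.inr j)) =
    subst (Sum.elim (fun i => X (Sum.inl (Sum.inl i))) (fun i => X (Sum.inr (Sum.inl i))) :
      ZW p → MvPowerSeries (Ambient p) ℂ) (M.E j) := by
  refine congrArg (subst · (M.E j)) (funext ?_)
  rintro (i | i) <;> rfl

theorem ambientParam_inr_inr (j : Fin p) : M.ambientParam (Sum.inr (Sum.inr j)) =
    subst (Sum.elim (fun i => X (Sum.inr (Sum.inl i))) (fun i => X (Sum.inl (Sum.inl i))) :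
      ZW p → MvPowerSeries (Ambient p) ℂ) (conj (M.E j)) := by
  refine (subst_subst_X_comp (hasSubst_X_comp (incl p)) Sum.swap (conj (M.E j))).trans ?_
  refine congrArg (subst · (conj (M.E j))) (funext ?_)
  rintro (i | i) <;> rfl

theorem ideal_eq_span :
    M.ideal = Ideal.span (Set.range fun i : Ambient p => X i - M.ambientParam i) := by
  have hz (j : Fin p) := M.ambientParam_inl_inr j
  have hw (j : Fin p) := M.ambientParam_inr_inr j
  apply le_antisymm <;> rw [ideal, Ideal.span_le]
  · rintro _ (⟨j, rfl⟩ | ⟨j, rfl⟩)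
    · exact Ideal.subset_span ⟨Sum.inl (Sum.inr j), by simp only [hz]⟩
    · exact Ideal.subset_span ⟨Sum.inr (Sum.inr j), by simp only [hw]⟩
  · have hincl (i : ZW p) : X (incl p i) - M.ambientParam (incl p i) = 0 := by
      rw [ambientParam_incl, sub_self]
    rintro _ ⟨(i | j) | (i | j), rfl⟩
    · exact Set.mem_of_eq_of_mem (hincl (Sum.inl i)) (Ideal.zero_mem _)
    · exact Ideal.subset_span (Or.inl ⟨j, by simp only [hz]⟩)
    · exact Set.mem_of_eq_of_mem (hincl (Sum.inr i)) (Ideal.zero_mem _)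
    · exact Ideal.subset_span (Or.inr ⟨j, by simp only [hw]⟩)

theorem mem_ideal_iff {r : MvPowerSeries (Ambient p) ℂ} :
    r ∈ M.ideal ↔ subst (pairing M.param) r = 0 := by
  have hP := hasSubst_pairing M.param
  have hincl := hasSubst_X_comp (R := ℂ) (incl p)
  rw [ideal_eq_span]
  constructor
  · suffices h : Ideal.span (Set.range fun i : Ambient p => X i - M.ambientParam i) ≤
        RingHom.ker (substAlgHom hP (R := ℂ)) from fun hr => by
      simpa only [RingHom.mem_ker, substAlgHom_apply] using h hr
    rw [Ideal.span_le]
    rintro _ ⟨i, rfl⟩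
    rw [SetLike.mem_coe, RingHom.mem_ker, substAlgHom_apply, subst_sub hP, subst_X hP,
      ambientParam, subst_subst_X_comp hP, funext M.pairing_param_incl, sub_eq_zero]
    exact (congrFun (subst_self (R := ℂ)) _).symm
  · intro hr
    have ha (i : Ambient p) : constantCoeff (M.ambientParam i) = 0 :=
      constantCoeff_subst_eq_zero hincl (fun _ => constantCoeff_X _)
        (constantCoeff_pairing M.param i)
    have h0 : subst M.ambientParam r = 0 := by
      have h := subst_comp_subst_apply hP hincl r
      rw [hr, ← substAlgHom_apply hincl, map_zero] at h
      exact h.symm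
    have h := subst_sub_subst_mem_span (a := X) constantCoeff_X ha r
    rwa [h0, sub_zero, congrFun subst_self r] at h

variable {M} {M' : FormalSubmanifold p}

theorem mapsInto_iff {f : FormalBihol (Fin p ⊕ Fin p)} : MapsInto f M M' ↔
    ∃ G : FormalMap (ZW p), G.IsReal ∧ (f : FormalMap (ZW p)) * M.param = M'.param * G := by
  simp only [MapsInto, mem_ideal_iff M, subst_pairing_complexify]
  constructor
  · intro h
    set F := (f : FormalMap (ZW p)) * M.param
    have hF := hasSubst_pairing F
    refine ⟨F.realify, F.isReal_realify, FormalMap.ext (funext ?_)⟩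
    rintro (i | j)
    · exact (subst_X (R := ℂ) F.realify.hasSubst (Sum.inl i)).symm
    · have hj := h (X (Sum.inl (Sum.inr j)) - M'.ambientParam (Sum.inl (Sum.inr j)))
        (M'.ideal_eq_span ▸ Ideal.subset_span ⟨_, rfl⟩)
      rw [subst_sub hF, subst_X hF, sub_eq_zero, ambientParam, subst_subst_X_comp hF] at hj
      refine hj.trans (congrArg (subst · (M'.E j)) (funext ?_))
      rintro (i | i) <;> rfl
  · rintro ⟨G, hG, hfG⟩ r hr
    rw [hfG, subst_pairing_mul _ hG, M'.mem_ideal_iff.mp hr, ← substAlgHom_apply G.hasSubst,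
      map_zero]

theorem eq_one_of_param_mul_eq {G : FormalMap (ZW p)} (hG : G.IsReal)
    (h : M.param * G = M.param) : G = 1 :=
  hG.ext .one fun i => (subst_X (R := ℂ) G.hasSubst (Sum.inl i)).symm.trans
    (congrFun (congrArg FormalMap.toFun h) (Sum.inl i))

theorem FormallyEquivalent.exists_lift (h : M.FormallyEquivalent M') :
    ∃ f F : FormalBihol (ZW p), (F : FormalMap (ZW p)).IsReal ∧ f * M.param = M'.param * F := by
  obtain ⟨f, hf, hf'⟩ := h
  obtain ⟨G, hG, hfG⟩ := mapsInto_iff.mp hf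
  obtain ⟨G', hG', hfG'⟩ := mapsInto_iff.mp hf'
  have hG'G : G' * G = 1 := eq_one_of_param_mul_eq (M := M) (hG'.mul hG) (by
    rw [← mul_assoc, ← hfG', mul_assoc, ← hfG, Units.inv_mul_cancel_left])
  have hGG' : G * G' = 1 := eq_one_of_param_mul_eq (M := M') (hG.mul hG') (by
    rw [← mul_assoc, ← hfG, mul_assoc, ← hfG', Units.mul_inv_cancel_left])
  exact ⟨f, ⟨G, G', hGG', hG'G⟩, hG, hfG⟩

theorem conj_mem_deck_iff {f F : FormalBihol (ZW p)} (h : f * M.param = M'.param * F)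
    (τ : FormalBihol (ZW p)) : F * τ * F⁻¹ ∈ M'.deck ↔ τ ∈ M.deck := by
  rw [mem_deck_iff, mem_deck_iff, Units.val_mul, Units.val_mul, ← mul_assoc, ← mul_assoc,
    Units.mul_inv_eq_iff_eq_mul, ← h, mul_assoc, Units.mul_right_inj]

theorem formallyEquivalent_of_deck_eq_map (hM : M.ConditionD) (hM' : M'.ConditionD)
    {F : FormalBihol (ZW p)} (hF : (F : FormalMap (ZW p)).IsReal)
    (h : M'.deck = M.deck.map (MulAut.conj F).toMonoidHom) : M.FormallyEquivalent M' := by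
  have hdeck {τ : FormalBihol (ZW p)} : F * τ * F⁻¹ ∈ M'.deck ↔ τ ∈ M.deck :=
    h ▸ Subgroup.mem_map_iff_mem (MulAut.conj F).injective
  obtain ⟨f, hf⟩ := exists_eq_mul_param hM (F := M'.param * F) fun τ hτ => by
    rwa [← hdeck, mem_deck_iff, Units.val_mul, Units.val_mul, ← mul_assoc, ← mul_assoc,
      Units.mul_inv_eq_iff_eq_mul] at hτ
  obtain ⟨g, hg⟩ := exists_eq_mul_param hM' (F := M.param * ↑F⁻¹) fun τ hτ => by
    have hFτ : F⁻¹ * τ * F ∈ M.deck := by rwa [← hdeck, ← mul_assoc, mul_inv_cancel_right,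
      ← mul_assoc, mul_inv_cancel, one_mul]
    rw [mem_deck_iff, Units.val_mul, Units.val_mul, ← mul_assoc, ← mul_assoc] at hFτ
    rw [Units.eq_mul_inv_iff_mul_eq, hFτ]
  have hgf : g * f = 1 := mul_param_cancel hM (by
    rw [mul_assoc, ← hf, ← mul_assoc, ← hg, mul_assoc, Units.inv_mul, mul_one, one_mul])
  have hfg : f * g = 1 := mul_param_cancel hM' (by
    rw [mul_assoc, ← hg, ← mul_assoc, ← hf, mul_assoc, Units.mul_inv, mul_one, one_mul])
  exact ⟨⟨f, g, hfg, hgf⟩, mapsInto_iff.mpr ⟨F, hF, hf.symm⟩, mapsInto_iff.mpr ⟨_, hF.inv, hg.symm⟩⟩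

theorem formallyEquivalent_iff (hM : M.ConditionD) (hM' : M'.ConditionD) :
    M.FormallyEquivalent M' ↔ ∃ F : FormalBihol (ZW p), (F : FormalMap (ZW p)).IsReal ∧
      M'.deck = M.deck.map (MulAut.conj F).toMonoidHom := by
  constructor
  · intro h
    obtain ⟨f, F, hF, hfF⟩ := h.exists_lift
    refine ⟨F, hF, Subgroup.ext fun τ => ?_⟩
    rw [Subgroup.mem_map_equiv, MulAut.conj_symm_apply, ← conj_mem_deck_iff hfF]
    simp only [mul_assoc, mul_inv_cancel_left, mul_inv_cancel, mul_one]
  · rintro ⟨F, hF, hdeck⟩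
    exact formallyEquivalent_of_deck_eq_map hM hM' hF hdeck

theorem formallyEquivalent_iff_familyEquivalent (hM : M.ConditionD) (hM' : M'.ConditionD)
    {τ τ' : Fin p → FormalBihol (ZW p)} (hτ : M.IsAssociatedFamily τ)
    (hτ' : M'.IsAssociatedFamily τ') :
    M.FormallyEquivalent M' ↔ FamilyEquivalent τ (rho0 p) τ' (rho0 p) := by
  simp only [formallyEquivalent_iff hM hM', FamilyEquivalent, intertwines_rho0_iff]
  refine exists_congr fun F => and_congr_right fun _ => ⟨fun hdeck => ?_, ?_⟩
  · obtain ⟨U, -, hU⟩ := exists_coordinates_deck_eq_range_conjFlip hM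
    have hU' : M'.deck = (conjFlip (U * F⁻¹)).range := by
      rw [hdeck, hU, conjFlip_mul_inv, MonoidHom.range_comp]
    obtain ⟨e, rfl⟩ := hτ.exists_eq_reflections_comp hU
    obtain ⟨e', rfl⟩ := hτ'.exists_eq_reflections_comp hU'
    refine ⟨e.trans e'.symm, fun j => ?_⟩
    simp only [Function.comp_apply, Equiv.trans_apply, Equiv.apply_symm_apply, reflections,
      conjFlip_mul_inv]
    rfl
  · rintro ⟨e, he⟩
    rw [← hτ.2.1, ← hτ'.2.1, MonoidHom.map_closure, ← Set.range_comp,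
      ← e.surjective.range_comp τ']
    exact congrArg (Subgroup.closure <| Set.range ·) (funext fun j => (he j).symm)

end FormalSubmanifold

section TangentSpace

variable {σ : Type} [Fintype σ]

theorem mem_tangentSpace {I : Ideal (MvPowerSeries σ ℂ)} {v : σ → ℂ} :
    v ∈ tangentSpace I ↔ ∀ r ∈ I, linCoeff r ⬝ᵥ v = 0 := by
  simp only [tangentSpace, Submodule.mem_iInf, LinearMap.mem_ker, differential_apply]

theorem tangentSpace_bot : tangentSpace (⊥ : Ideal (MvPowerSeries σ ℂ)) = ⊤ := by
  refine eq_top_iff.mpr fun v _ => mem_tangentSpace.mpr ?_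
  rintro _ rfl
  rw [map_zero, zero_dotProduct]

variable [DecidableEq σ]

theorem tangentSpace_fixIdeal_le_eqLocus (F : FormalBihol σ) :
    tangentSpace (fixIdeal F) ≤ LinearMap.eqLocus (toLin' (linearPart F)) LinearMap.id := by
  intro v hv
  rw [LinearMap.mem_eqLocus, LinearMap.id_apply, toLin'_apply]
  ext i
  have h := mem_tangentSpace.mp hv (comps F i - X i)
    (Ideal.le_radical (Ideal.subset_span ⟨i, rfl⟩))
  rwa [map_sub, linCoeff_comps, linCoeff_X, sub_dotProduct, single_one_dotProduct,
    sub_eq_zero] at h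

theorem exists_tangentSpace_fixIdeal_eq {F : FormalBihol σ} (hF : IsOfFinOrder F)
    {A : Matrix σ σ ℂ} (hA : IsUnit A) {d : σ → ℂ} (hAF : A * linearPart F = diagonal d * A)
    (hfix : Module.finrank ℂ (tangentSpace (fixIdeal F)) + 1 = Fintype.card σ) :
    ∃ k, (∀ i, d i ≠ 1 ↔ i = k) ∧
      tangentSpace (fixIdeal F) = (coordSubspace ℂ {k}).comap (toLin' A) := by
  set N : Finset σ := {i | d i ≠ 1} with hN
  have hmem (i : σ) : i ∈ N ↔ d i ≠ 1 := by simp [hN]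
  have hle : tangentSpace (fixIdeal F) ≤ (coordSubspace ℂ N).comap (toLin' A) :=
    (tangentSpace_fixIdeal_le_eqLocus F).trans_eq (eqLocus_eq_comap_coordSubspace hA hAF N hmem)
  have hrank := finrank_comap_coordSubspace hA N
  have hN0 : N.card ≠ 0 := by
    intro h0
    have hd : d = 1 := funext fun i => by
      by_contra hi
      exact Finset.card_ne_zero_of_mem ((hmem i).mpr hi) h0
    have hF1 : F = 1 := eq_one_of_isOfFinOrder_of_linearPart_eq_one hF
      (hA.mul_left_cancel (by rw [hAF, hd, diagonal_one', one_mul, mul_one]))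
    rw [hF1, fixIdeal_one, tangentSpace_bot, finrank_top,
      Module.finrank_fintype_fun_eq_card] at hfix
    omega
  have hN1 : N.card = 1 := by
    have := Submodule.finrank_mono hle
    omega
  obtain ⟨k, hk⟩ := Finset.card_eq_one.mp hN1
  refine ⟨k, fun i => by rw [← hmem, hk, Finset.mem_singleton], ?_⟩
  rw [← hk]
  exact Submodule.eq_of_le_of_finrank_eq hle (by omega)

theorem injective_of_finrank_iInf_comap_coordSubspace {ι : Type*} [Fintype ι]
    {A : Matrix σ σ ℂ} (hA : IsUnit A) {k : ι → σ}
    (hk : Module.finrank ℂ (⨅ j, (coordSubspace ℂ {k j}).comap (toLin' A) :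
      Submodule ℂ (σ → ℂ)) + Fintype.card ι = Fintype.card σ) : Function.Injective k := by
  have hinf : (⨅ j, (coordSubspace ℂ {k j}).comap (toLin' A) : Submodule ℂ (σ → ℂ)) =
      (coordSubspace ℂ (Finset.univ.image k)).comap (toLin' A) := by
    ext v
    simp only [Submodule.mem_iInf, Submodule.mem_comap, mem_coordSubspace, Finset.mem_singleton,
      forall_eq, Finset.mem_image, Finset.mem_univ, true_and, forall_exists_index,
      forall_apply_eq_imp_iff]
  have hrank := finrank_comap_coordSubspace hA (Finset.univ.image k)
  rw [← hinf] at hrank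
  have hcard : (Finset.univ.image k).card = (Finset.univ : Finset ι).card := by
    rw [Finset.card_univ]
    omega
  rwa [Finset.card_image_iff, Finset.coe_univ, Set.injOn_univ] at hcard

end TangentSpace

section CommutingInvolutions

variable {G : Type*} [Group G]

/-- The homomorphism from `{±1}` that maps `-1` to a given element of order at most two. -/
def signHom (g : G) (hg : g * g = 1) : ℤˣ →* G where
  toFun s := if s = 1 then 1 else g
  map_one' := if_pos rfl
  map_mul' s t := by
    obtain rfl | rfl := Int.units_eq_one_or s <;> obtain rfl | rfl := Int.units_eq_one_or t <;>
      simp [hg]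

theorem signHom_neg_one (g : G) (hg : g * g = 1) : signHom g hg (-1) = g := by
  simp [signHom]

variable {p : ℕ}

theorem exists_hom_signAt_eq {τ : Fin p → G} (hτ : ∀ j, τ j * τ j = 1)
    (hcomm : ∀ i j, τ i * τ j = τ j * τ i) :
    ∃ ψ : (Fin p → ℤˣ) →* G, ∀ j, ψ (signAt j) = τ j := by
  have hpair : Pairwise fun i j => ∀ s t : ℤˣ,
      Commute (signHom (τ i) (hτ i) s) (signHom (τ j) (hτ j) t) := by
    intro i j _ s t
    obtain rfl | rfl := Int.units_eq_one_or s
    · rw [map_one]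
      exact Commute.one_left _
    obtain rfl | rfl := Int.units_eq_one_or t
    · rw [map_one]
      exact Commute.one_right _
    rw [signHom_neg_one, signHom_neg_one]
    exact hcomm i j
  refine ⟨MonoidHom.noncommPiCoprod (fun j => signHom (τ j) (hτ j)) hpair, fun j => ?_⟩
  rw [signAt, MonoidHom.noncommPiCoprod_mulSingle, signHom_neg_one]

theorem signVec_signAt_ne_one_iff {j : Fin p} {i : ZW p} :
    signVec (signAt j) i ≠ 1 ↔ i = Sum.inr j := by
  rcases i with i | k
  · simp [signVec_inl]
  · rw [signVec_inr, Sum.inr.injEq, ← signAt_apply_ne_one_iff (j := j)]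
    simp

theorem apply_signAt_eq_of_ne_one_iff {χ χ' : (Fin p → ℤˣ) →* ℂ} {j : Fin p}
    (h : χ (signAt j) ≠ 1 ↔ χ' (signAt j) ≠ 1) : χ (signAt j) = χ' (signAt j) := by
  have hsq (χ : (Fin p → ℤˣ) →* ℂ) : χ (signAt j) = 1 ∨ χ (signAt j) = -1 := by
    have hs : signAt j * signAt j = 1 := funext fun k => Int.units_mul_self _
    rw [← mul_self_eq_one_iff, ← map_mul, hs, map_one]
  obtain h1 | h1 := hsq χ <;> obtain h2 | h2 := hsq χ' <;> simp_all

theorem exists_coordinates_eq_reflections (ψ : (Fin p → ℤˣ) →* FormalBihol (ZW p))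
    {A : Matrix (ZW p) (ZW p) ℂ} (hA : IsUnit A) {χ : ZW p → (Fin p → ℤˣ) →* ℂ}
    (hAψ : ∀ s, A * linearPart (ψ s) = diagonal (χ · s) * A) {k : Fin p → ZW p}
    (hk : Function.Injective k) (hχ : ∀ j i, χ i (signAt j) ≠ 1 ↔ i = k j) :
    ∃ U : FormalBihol (ZW p), ∀ j, ψ (signAt j) = reflections U j := by
  obtain ⟨π, hπ⟩ := Equiv.Perm.exists_extending_pair (Sum.inr : Fin p → ZW p) k
    Sum.inr_injective hk
  have hAπ : IsUnit (A.submatrix π id) := by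
    rw [← linearIndependent_rows_iff_isUnit] at hA ⊢
    exact hA.comp π π.injective
  obtain ⟨U, -, hU⟩ := exists_diagonalizing_coordinates ψ (fun i => χ (π i)) hAπ fun s =>
    Matrix.ext fun i l => by
      have h := congrFun₂ (hAψ s) (π i) l
      rw [diagonal_mul] at h ⊢
      exact h
  refine ⟨U, fun j => eq_conjFlip_iff.mpr (mul_eq_flip_mul_iff.mpr fun i => ?_)⟩
  have hsign : χ (π i) (signAt j) = signVec (signAt j) i :=
    apply_signAt_eq_of_ne_one_iff (χ' := (Pi.evalMonoidHom _ i).comp signVec) (by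
      rw [hχ, ← hπ, π.injective.eq_iff]
      exact signVec_signAt_ne_one_iff.symm)
  rw [hU, hsign]

theorem exists_eq_reflections {τ : Fin p → FormalBihol (ZW p)} (hτ : ∀ j, τ j * τ j = 1)
    (hcomm : ∀ i j, τ i * τ j = τ j * τ i)
    (hfix : ∀ j, Module.finrank ℂ (tangentSpace (fixIdeal (τ j))) + 1 = 2 * p)
    (htrans : Module.finrank ℂ
      (⨅ j, tangentSpace (fixIdeal (τ j)) : Submodule ℂ (ZW p → ℂ)) + p = 2 * p) :
    ∃ U : FormalBihol (ZW p), τ = reflections U := by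
  have hcard : Fintype.card (ZW p) = 2 * p := by simp [two_mul]
  obtain ⟨ψ, hψ⟩ := exists_hom_signAt_eq hτ hcomm
  obtain ⟨A, χ, hA, hAψ⟩ := exists_mul_eq_diagonal_mul
    ((jacobian.comp (Units.coeHom _)).comp ψ) (fun s t => (Commute.all s t).map _)
    fun s => MonoidHom.isOfFinOrder _ (isOfFinOrder_of_finite s)
  have hord (j : Fin p) : IsOfFinOrder (τ j) := hψ j ▸ ψ.isOfFinOrder (isOfFinOrder_of_finite _)
  have hAτ (j : Fin p) : A * linearPart (τ j) = diagonal (χ · (signAt j)) * A := by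
    rw [← hψ j]
    exact hAψ (signAt j)
  choose k hk htan using fun j => exists_tangentSpace_fixIdeal_eq (hord j) hA
    (hAτ j) ((hfix j).trans hcard.symm)
  rw [iInf_congr htan] at htrans
  have hinj : Function.Injective k :=
    injective_of_finrank_iInf_comap_coordSubspace hA (by rw [Fintype.card_fin, htrans, hcard])
  obtain ⟨U, hU⟩ := exists_coordinates_eq_reflections ψ hA hAψ hinj hk
  exact ⟨U, funext fun j => (hψ j).symm.trans (hU j)⟩

end CommutingInvolutions

section IntertwiningCoordinates

variable {p : ℕ}

theorem comps_bar {σ : Type} [Finite σ] (F : FormalBihol σ) (i : σ) :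
    comps (bar F) i = conj (comps F i) := rfl

theorem bar_bar (F : FormalBihol (ZW p)) : bar (bar F) = F :=
  Units.ext (FormalMap.bar_bar _)

theorem bar_flip (s : Fin p → ℤˣ) : bar (flip s) = flip s := by
  refine formalBihol_ext ?_
  rintro (i | k)
  all_goals simp [comps_bar, comps_flip, conj, smul_eq_C_mul, signVec_inl, signVec_inr]

theorem AntiInvolution.bar_mul_R {σ : Type} [Finite σ] (ρ : AntiInvolution σ) :
    bar ρ.R * ρ.R = 1 := mul_eq_one_comm.mp ρ.invol

theorem bar_mul_conjugate {U g : FormalBihol (ZW p)} {s : Fin p → ℤˣ}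
    (h : U * g = flip s * U) (ρ : AntiInvolution (ZW p)) :
    bar (U * ρ.R) * ρ.conjugate g = flip s * bar (U * ρ.R) :=
  calc bar (U * ρ.R) * ρ.conjugate g
      = bar U * (bar ρ.R * ρ.R) * bar g * bar ρ.R := by
        rw [map_mul, AntiInvolution.conjugate]
        simp only [mul_assoc]
    _ = bar (U * g) * bar ρ.R := by rw [ρ.bar_mul_R, mul_one, map_mul]
    _ = flip s * bar (U * ρ.R) := by rw [h, map_mul, map_mul, bar_flip, mul_assoc]

theorem intertwines_rho0_of_comps_inr {Φ : FormalBihol (ZW p)} {ρ : AntiInvolution (ZW p)}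
    (h : ∀ i, comps Φ (Sum.inr i) = comps (bar (Φ * ρ.R)) (Sum.inl i)) :
    Intertwines Φ ρ (rho0 p) := by
  have hrho0 (i : ZW p) : comps ((rho0 p).R * bar Φ) i = comps (bar Φ) i.swap :=
    swap_mul_toFun _ i
  refine formalBihol_ext ?_
  rintro (i | i)
  · rw [hrho0, Sum.swap_inl, comps_bar, h, ← comps_bar, bar_bar]
  · rw [hrho0, Sum.swap_inr, comps_mul, h, ← comps_mul, map_mul, mul_assoc, ρ.bar_mul_R, mul_one]

theorem dotProductEquiv_mem_linearInvariants {𝓕 : Fin p → FormalBihol (ZW p)}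
    {U : FormalBihol (ZW p)} {s : Fin p → Fin p → ℤˣ} (h : ∀ j, U * 𝓕 j = flip (s j) * U)
    {v : ZW p → ℂ} (hv : v ∈ Submodule.span ℂ (Set.range fun i => linearPart U (Sum.inl i))) :
    dotProductEquiv ℂ (ZW p) v ∈ linearInvariants 𝓕 := by
  refine (Submodule.mem_iInf _).mpr fun j => LinearMap.ext fun x => ?_
  have hvj : v ᵥ* linearPart (𝓕 j) = v := by
    suffices hle : Submodule.span ℂ (Set.range fun i => linearPart U (Sum.inl i)) ≤
        LinearMap.eqLocus (linearPart (𝓕 j)).vecMulLinear LinearMap.id from hle hv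
    rw [Submodule.span_le]
    rintro _ ⟨i, rfl⟩
    have hlin := congrArg linearPart (h j)
    rw [linearPart_mul, linearPart_mul, linearPart_flip] at hlin
    refine (mul_apply_eq_vecMul _ _ _).symm.trans ((congrFun hlin _).trans (funext fun l => ?_))
    rw [diagonal_mul, signVec_inl, one_mul]
    rfl
  change v ⬝ᵥ toLin' (linearPart (𝓕 j)) x = v ⬝ᵥ x
  rw [toLin'_apply, dotProduct_mulVec, hvj]

theorem exists_comps_eq_sumElim {𝓕 𝓖 : Fin p → FormalBihol (ZW p)} {U W : FormalBihol (ZW p)}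
    {s t : Fin p → Fin p → ℤˣ} (hU : ∀ j, U * 𝓕 j = flip (s j) * U)
    (hW : ∀ j, W * 𝓖 j = flip (t j) * W)
    (hinv : linearInvariants 𝓕 ⊓ linearInvariants 𝓖 = ⊥) :
    ∃ Φ : FormalBihol (ZW p),
      comps Φ = Sum.elim (fun i => comps U (Sum.inl i)) fun i => comps W (Sum.inl i) := by
  have hrows (V : FormalBihol (ZW p)) :
      LinearIndependent ℂ fun i : Fin p => linearPart V (Sum.inl i) :=
    (linearIndependent_rows_iff_isUnit.mpr (isUnit_linearPart V)).comp Sum.inl Sum.inl_injective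
  have hdisj : Disjoint (Submodule.span ℂ (Set.range fun i => linearPart U (Sum.inl i)))
      (Submodule.span ℂ (Set.range fun i => linearPart W (Sum.inl i))) := by
    refine Submodule.disjoint_def.mpr fun v hvU hvW => ?_
    have hv : dotProductEquiv ℂ (ZW p) v ∈ linearInvariants 𝓕 ⊓ linearInvariants 𝓖 :=
      ⟨dotProductEquiv_mem_linearInvariants hU hvU, dotProductEquiv_mem_linearInvariants hW hvW⟩
    rw [hinv, Submodule.mem_bot] at hv
    exact (dotProductEquiv ℂ (ZW p)).map_eq_zero_iff.mp hv
  refine exists_formalBihol_comps_eq ?_ (linearIndependent_rows_iff_isUnit.mp ?_)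
  · rintro (i | i) <;> exact constantCoeff_comps _ _
  · convert! (hrows U).sum_type (hrows W) hdisj using 1
    ext1 (i | i) <;> rfl

theorem exists_intertwining_coordinates {U : FormalBihol (ZW p)} {ρ : AntiInvolution (ZW p)}
    (hinv : linearInvariants (reflections U) ⊓
      linearInvariants (fun j => ρ.conjugate (reflections U j)) = ⊥) :
    ∃ Φ : FormalBihol (ZW p), (∀ i, comps Φ (Sum.inl i) = comps U (Sum.inl i)) ∧
      Intertwines Φ ρ (rho0 p) := by
  have hU (j : Fin p) : U * reflections U j = flip (signAt j) * U := eq_conjFlip_iff.mp rfl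
  obtain ⟨Φ, hΦ⟩ := exists_comps_eq_sumElim hU (fun j => bar_mul_conjugate (hU j) ρ) hinv
  have hz (i : Fin p) : comps Φ (Sum.inl i) = comps U (Sum.inl i) := congrFun hΦ (Sum.inl i)
  refine ⟨Φ, hz, intertwines_rho0_of_comps_inr fun i => (congrFun hΦ (Sum.inr i)).trans ?_⟩
  rw [Sum.elim_inr, comps_bar, comps_bar, comps_mul, comps_mul, hz]

end IntertwiningCoordinates

section SquareManifold

variable {p : ℕ}

/-- The formal submanifold `z'' = (B₁², …, B_p²)(z', \bar z')`, where `B₁, …, B_p` are the last `p`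
components of `V`. -/
def squareManifold (V : FormalBihol (ZW p)) : FormalSubmanifold p where
  E j := comps V (Sum.inr j) ^ 2
  two_le_order _ := le_order_pow_of_constantCoeff_eq_zero 2 (constantCoeff_comps V _)

variable {V : FormalBihol (ZW p)}

theorem param_squareManifold (hV : (V : FormalMap (ZW p)).IsFiberwise) :
    (squareManifold V).param = squareMap p * (V : FormalMap (ZW p)) := by
  have hcomp (i : ZW p) : (squareMap p * (V : FormalMap (ZW p))).toFun i =
      comps V i ^ squareExponent i := by
    change subst (comps V) (X i ^ squareExponent i) = _
    rw [subst_pow (hasSubst_comps V), subst_X (hasSubst_comps V)]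
  refine FormalMap.ext (funext ?_)
  rintro (i | j)
  · exact ((hcomp _).trans ((pow_one _).trans (hV i))).symm
  · exact (hcomp _).symm

theorem exists_flip_eq {h : FormalBihol (ZW p)}
    (hh : squareMap p * (h : FormalMap (ZW p)) = squareMap p) : ∃ s, flip s = h := by
  have hcomp (i : ZW p) :
      comps h i ^ squareExponent i = (X i : MvPowerSeries (ZW p) ℂ) ^ squareExponent i := by
    refine Eq.trans ?_ (congrFun (congrArg FormalMap.toFun hh) i)
    change _ = subst (comps h) (X i ^ squareExponent i)
    rw [subst_pow (hasSubst_comps h), subst_X (hasSubst_comps h)]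
  have hsign (k : Fin p) :
      ∃ s : ℤˣ, ((s : ℤ) : ℂ) • (X (Sum.inr k) : MvPowerSeries (ZW p) ℂ) =
        comps h (Sum.inr k) := by
    obtain hk | hk := sq_eq_sq_iff_eq_or_eq_neg.mp (hcomp (Sum.inr k))
    · exact ⟨1, by simp [hk]⟩
    · exact ⟨-1, by simp [hk]⟩
  choose s hs using hsign
  refine ⟨s, formalBihol_ext ?_⟩
  rintro (i | k)
  · rw [comps_flip, Pi.smul_apply', signVec_inl, one_smul]
    exact ((pow_one _).symm.trans ((hcomp (Sum.inl i)).trans (pow_one _))).symm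
  · exact hs k

theorem deck_squareManifold (hV : (V : FormalMap (ZW p)).IsFiberwise) :
    (squareManifold V).deck = (conjFlip V).range := by
  ext g
  rw [FormalSubmanifold.mem_deck_iff, param_squareManifold hV, MonoidHom.mem_range]
  constructor
  · intro hg
    obtain ⟨s, hs⟩ := exists_flip_eq (h := V * g * V⁻¹) (by
      rw [Units.val_mul, Units.val_mul, ← mul_assoc, ← mul_assoc, hg, Units.mul_inv_cancel_right])
    exact ⟨s, (eq_conjFlip_iff.mpr (by rw [hs, inv_mul_cancel_right])).symm⟩
  · rintro ⟨s, rfl⟩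
    rw [mul_assoc, ← Units.val_mul, eq_conjFlip_iff.mp rfl, Units.val_mul, ← mul_assoc,
      squareMap_mul_flip]

theorem conditionD_squareManifold (hV : (V : FormalMap (ZW p)).IsFiberwise) :
    (squareManifold V).ConditionD := by
  constructor
  · intro w hw
    have hparam : (squareManifold V).param = 1 * squareMap p * V := by
      rw [one_mul, param_squareManifold hV]
    have hVw : (V : FormalMap (ZW p)).wBlock *ᵥ w = 0 := funext fun j => by
      have hq := hw j
      rw [FormalSubmanifold.eval_q_of_param_eq hV hparam, FormalMap.wBlock_one,
        one_mulVec] at hq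
      exact eq_zero_of_pow_eq_zero hq
    refine mulVec_injective_iff_isUnit.mpr (hV.isUnit_iff_isUnit_wBlock.mp V.isUnit) ?_
    rw [hVw, mulVec_zero]
  · rw [deck_squareManifold hV,
      ← Nat.card_congr (MonoidHom.ofInjective (conjFlip_injective V)).toEquiv]
    simp

end SquareManifold

theorem exists_realization {p : ℕ} {τ : Fin p → FormalBihol (ZW p)} {ρ : AntiInvolution (ZW p)}
    (hτ : ∀ j, τ j * τ j = 1) (hcomm : ∀ i j, τ i * τ j = τ j * τ i)
    (hfix : ∀ j, Module.finrank ℂ (tangentSpace (fixIdeal (τ j))) + 1 = 2 * p)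
    (htrans : Module.finrank ℂ
      (⨅ j, tangentSpace (fixIdeal (τ j)) : Submodule ℂ (ZW p → ℂ)) + p = 2 * p)
    (hinv : linearInvariants τ ⊓ linearInvariants (fun j => ρ.conjugate (τ j)) = ⊥) :
    ∃ (B : Fin p → MvPowerSeries (ZW p) ℂ) (M : FormalSubmanifold p),
      (∀ j, M.E j = B j ^ 2) ∧ M.ConditionD ∧
        ∃ τ' : Fin p → FormalBihol (ZW p), M.IsAssociatedFamily τ' ∧
          FamilyEquivalent τ ρ τ' (rho0 p) := by
  obtain ⟨U, rfl⟩ := exists_eq_reflections hτ hcomm hfix htrans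
  obtain ⟨Φ, hΦU, hΦρ⟩ := exists_intertwining_coordinates hinv
  have hV : ((U * Φ⁻¹ : FormalBihol (ZW p)) : FormalMap (ZW p)).IsFiberwise := fun i => by
    change comps (U * Φ⁻¹) (Sum.inl i) = _
    rw [comps_mul, ← hΦU, ← comps_mul, mul_inv_cancel, comps_one]
  refine ⟨fun j => comps (U * Φ⁻¹) (Sum.inr j), squareManifold (U * Φ⁻¹), fun _ => rfl,
    conditionD_squareManifold hV, reflections (U * Φ⁻¹),
    FormalSubmanifold.isAssociatedFamily_reflections (deck_squareManifold hV), Φ, hΦρ, 1,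
    fun j => ?_⟩
  rw [Equiv.Perm.one_apply, reflections, reflections, conjFlip_mul_inv]
  rfl

end CRSing

end

theorem mainTheorem12_general (p : ℕ) :
    (∀ M : CRSing.FormalSubmanifold p, M.ConditionD →
      ∃ τ : Fin p → CRSing.FormalBihol (CRSing.ZW p), M.IsAssociatedFamily τ ∧
        ∀ τ' : Fin p → CRSing.FormalBihol (CRSing.ZW p), M.IsAssociatedFamily τ' →
          Set.range τ' = Set.range τ) ∧
    (∀ M M' : CRSing.FormalSubmanifold p, M.ConditionD → M'.ConditionD →
      ∀ τ τ' : Fin p → CRSing.FormalBihol (CRSing.ZW p),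
        M.IsAssociatedFamily τ → M'.IsAssociatedFamily τ' →
          (M.FormallyEquivalent M' ↔
            CRSing.FamilyEquivalent τ (CRSing.rho0 p) τ' (CRSing.rho0 p))) ∧
    (∀ (τ : Fin p → CRSing.FormalBihol (CRSing.ZW p)) (ρ : CRSing.AntiInvolution (CRSing.ZW p)),
      (∀ j, τ j * τ j = 1) →
      (∀ i j, τ i * τ j = τ j * τ i) →
      (∀ j, Module.finrank ℂ (CRSing.tangentSpace (CRSing.fixIdeal (τ j))) + 1 = 2 * p) →
      Module.finrank ℂ
        (⨅ j, CRSing.tangentSpace (CRSing.fixIdeal (τ j)) :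
          Submodule ℂ (CRSing.ZW p → ℂ)) + p = 2 * p →
      CRSing.linearInvariants τ ⊓
        CRSing.linearInvariants (fun j => ρ.conjugate (τ j)) = ⊥ →
      ∃ (B : Fin p → MvPowerSeries (CRSing.ZW p) ℂ) (M : CRSing.FormalSubmanifold p),
        (∀ j, M.E j = B j ^ 2) ∧ M.ConditionD ∧
          ∃ τ' : Fin p → CRSing.FormalBihol (CRSing.ZW p), M.IsAssociatedFamily τ' ∧
            CRSing.FamilyEquivalent τ ρ τ' (CRSing.rho0 p)) :=
  ⟨fun _ hM => CRSing.FormalSubmanifold.existsUnique_associatedFamily hM,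
    fun _ _ hM hM' _ _ hτ hτ' =>
      CRSing.FormalSubmanifold.formallyEquivalent_iff_familyEquivalent hM hM' hτ hτ',
    fun _ _ => CRSing.exists_realization⟩

theorem mainTheorem12 (p : ℕ) :
    -- the associated family of involutions exists and is unique up to the order of its members
    (∀ M : CRSing.FormalSubmanifold p, M.ConditionD →
      ∃ τ : Fin p → CRSing.FormalBihol (CRSing.ZW p), M.IsAssociatedFamily τ ∧
        ∀ τ' : Fin p → CRSing.FormalBihol (CRSing.ZW p), M.IsAssociatedFamily τ' →
          Set.range τ' = Set.range τ) ∧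
    -- formal equivalence of the manifolds is equivalence of the families
    (∀ M M' : CRSing.FormalSubmanifold p, M.ConditionD → M'.ConditionD →
      ∀ τ τ' : Fin p → CRSing.FormalBihol (CRSing.ZW p),
        M.IsAssociatedFamily τ → M'.IsAssociatedFamily τ' →
          (M.FormallyEquivalent M' ↔
            CRSing.FamilyEquivalent τ (CRSing.rho0 p) τ' (CRSing.rho0 p))) ∧
    -- realization of abstract families
    (∀ (τ : Fin p → CRSing.FormalBihol (CRSing.ZW p)) (ρ : CRSing.AntiInvolution (CRSing.ZW p)),
      (∀ j, τ j * τ j = 1) →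
      (∀ i j, τ i * τ j = τ j * τ i) →
      -- the tangent spaces of `Fix(τ_j)` are hyperplanes
      (∀ j, Module.finrank ℂ (CRSing.tangentSpace (CRSing.fixIdeal (τ j))) + 1 = 2 * p) →
      -- they intersect transversally: the intersection has codimension `p`
      Module.finrank ℂ
        (⨅ j, CRSing.tangentSpace (CRSing.fixIdeal (τ j)) :
          Submodule ℂ (CRSing.ZW p → ℂ)) + p = 2 * p →
      -- `σ = τ₁ ∘ τ₂`, with `τ_i = τ_{i1} ⋯ τ_{ip}`, has distinct eigenvalues
      (CRSing.linearPart (CRSing.composite τ *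
        CRSing.composite fun j => ρ.conjugate (τ j))).charpoly.roots.Nodup →
      CRSing.linearInvariants τ ⊓
        CRSing.linearInvariants (fun j => ρ.conjugate (τ j)) = ⊥ →
      ∃ (B : Fin p → MvPowerSeries (CRSing.ZW p) ℂ) (M : CRSing.FormalSubmanifold p),
        (∀ j, M.E j = B j ^ 2) ∧ M.ConditionD ∧
          ∃ τ' : Fin p → CRSing.FormalBihol (CRSing.ZW p), M.IsAssociatedFamily τ' ∧
            CRSing.FamilyEquivalent τ ρ τ' (CRSing.rho0 p)) := by
  obtain ⟨existsUnique, equivalence, realization⟩ := mainTheorem12_general p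
  exact ⟨existsUnique, equivalence, fun τ ρ hτ hcomm hfix htrans _ hinv =>
    realization τ ρ hτ hcomm hfix htrans hinv⟩
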